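/- Let $\kappa>0$ and $D_\kappa=\pi/\sqrt{\kappa}$. Let $X$ be a complete $\mathrm{CAT}(\kappa)$ space such that $d(w,w')<D_\kappa/2$ for all $w,w'\in X$, and let $f\colon X\to(-\infty,\infty]$ be a proper lower semicontinuous convex function, where convexity means $f(\alpha x\oplus(1-\alpha)y)\le\alpha f(x)+(1-\alpha)f(y)$ for all $x,y\in X$ and $\alpha\in(0,1)$. Here $\alpha x\oplus(1-\alpha)y$ denotes the point $c((1-\alpha)d(x,y))$, with $c\colon[0,d(x,y)]\to X$ the geodesic path from $x$ to $y$. Write $\operatorname{Argmin}_X f$ for the set of all minimizers of $f$. For $\eta>0$ and $x\in X$ set $$\tilde R_{\eta f}x=\operatorname*{Argmin}_{y\in X}\Bigl\{f(y)+\frac1\eta\tan\bigl(\sqrt\kappa\,d(y,x)\bigr)\sin\bigl(\sqrt\kappa\,d(y,x)\bigr)\Bigr\}.$$ This minimizer exists and is unique, so that $\tilde R_{\eta f}\colon X\to X$ is a well-defined mapping. Moreover, let $\{x_n\}$ be a sequence defined by $x_1\in X$ and $$x_{n+1}=\alpha_nx_n\oplus(1-\alpha_n)\tilde R_{\lambda_nf}x_n\qquad(n=1,2,\dots),$$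 where $\{\alpha_n\}$ is a sequence in $[0,1)$ and $\{\lambda_n\}$ is a sequence of positive real numbers such that $\sum_{n=1}^\infty(1-\alpha_n)\lambda_n=\infty$. Then the following hold. (i) $\operatorname{Argmin}_Xf$ is nonempty if and only if $$\inf_{y\in X}\limsup_{n\to\infty}d(y,\tilde R_{\lambda_nf}x_n)<\frac{D_\kappa}2\quad\text{and}\quad\sup_nd(\tilde R_{\lambda_nf}x_n,x_n)<\frac{D_\kappa}2.$$ (ii) If $\operatorname{Argmin}_Xf$ is nonempty and $\sup_n\alpha_n<1$, then both $\{x_n\}$ and $\{\tilde R_{\lambda_nf}x_n\}$ are $\Delta$-convergent to one and the same element $x_\infty$ of $\operatorname{Argmin}_Xf$. Here a sequence $\{u_n\}$ in $X$ is said to be $\Delta$-convergent to $p\in X$ if, for each subsequence $\{u_{n_i}\}$, the point $p$ is the only $z\in X$ with $\limsup_id(z,u_{n_i})=\inf_{y\in X}\limsup_id(y,u_{n_i})$. -/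

import Mathlib

open Set Filter

noncomputable section

namespace CATProx

/-- `D_κ = π / √κ`, the diameter of the model surface of constant curvature `κ > 0`. -/
def diamModel (κ : ℝ) : ℝ := Real.pi / √κ

/-- `c` (on the interval `[0, d x y]`) is a geodesic path from `x` to `y` with respect to the
distance function `d`. Values of `c` outside this interval are irrelevant. -/
def IsGeodesicPath {M : Type*} (d : M → M → ℝ) (c : ℝ → M) (x y : M) : Prop :=
  c 0 = x ∧ c (d x y) = y ∧
    ∀ s ∈ Icc (0 : ℝ) (d x y), ∀ t ∈ Icc (0 : ℝ) (d x y), d (c s) (c t) = |s - t|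

/-- The geodesic segment `[x, y]_c`, the image of the geodesic path `c` from `x` to `y`. -/
def geodesicSegment {M : Type*} (d : M → M → ℝ) (c : ℝ → M) (x y : M) : Set M :=
  c '' Icc (0 : ℝ) (d x y)

/-- The unit sphere `𝕊²` of Euclidean three-space, underlying set of the model surface. -/
abbrev ModelSphere : Type := Metric.sphere (0 : EuclideanSpace ℝ (Fin 3)) 1

/-- The metric of the model surface `M_κ`, `κ > 0`: the spherical (angular) metric of `𝕊²`
divided by `√κ`. -/
def modelDist (κ : ℝ) (u v : ModelSphere) : ℝ :=
  (1 / √κ) * Real.arccos (inner ℝ (u : EuclideanSpace ℝ (Fin 3)) (v : EuclideanSpace ℝ (Fin 3)))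

/-- `CAT(κ)` spaces for `κ > 0`. Vertices of a triangle are indexed by `Fin 3`, and its `i`-th
side joins the `i`-th vertex to the `(i+1)`-st one, cyclically. -/
structure IsCAT (κ : ℝ) (X : Type*) [MetricSpace X] : Prop where
  /-- Points at distance less than `D_κ` are joined by a geodesic path. -/
  geodesic : ∀ x y : X, dist x y < diamModel κ → ∃ c : ℝ → X, IsGeodesicPath dist c x y
  /-- The `CAT(κ)` inequality: for each geodesic triangle of perimeter less than `2 D_κ` in `X`
  (vertices `x i`, sides `c i`) and each comparison triangle in `M_κ` (vertices `x' i`, sides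
  `c' i`), and for comparison points `p'` and `q'` of points `p` and `q` of the triangle, the
  distance of `p` and `q` is at most that of `p'` and `q'`. -/
  comparison : ∀ (x : Fin 3 → X) (c : Fin 3 → ℝ → X)
      (x' : Fin 3 → ModelSphere) (c' : Fin 3 → ℝ → ModelSphere),
    dist (x 0) (x 1) + dist (x 1) (x 2) + dist (x 2) (x 0) < 2 * diamModel κ →
    (∀ i, IsGeodesicPath dist (c i) (x i) (x (i + 1))) →
    (∀ i j, dist (x i) (x j) = modelDist κ (x' i) (x' j)) →
    (∀ i, IsGeodesicPath (modelDist κ) (c' i) (x' i) (x' (i + 1))) →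
    ∀ i j : Fin 3,
    ∀ p ∈ geodesicSegment dist (c i) (x i) (x (i + 1)),
    ∀ p' ∈ geodesicSegment (modelDist κ) (c' i) (x' i) (x' (i + 1)),
    dist (x i) p = modelDist κ (x' i) p' →
    ∀ q ∈ geodesicSegment dist (c j) (x j) (x (j + 1)),
    ∀ q' ∈ geodesicSegment (modelDist κ) (c' j) (x' j) (x' (j + 1)),
    dist (x j) q = modelDist κ (x' j) q' →
    dist p q ≤ modelDist κ p' q'

section

variable {X : Type*} [MetricSpace X]

/-- `z = α x ⊕ (1 - α) y`, that is, `z = c ((1 - α) d(x, y))` for a geodesic path `c` from `x`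
to `y`. In a `CAT(κ)` space with `d(x, y) < D_κ` there is exactly one such `z`, for each `α` in
`[0, 1]`. -/
def IsConvexComb (a : ℝ) (x y z : X) : Prop :=
  ∃ c : ℝ → X, IsGeodesicPath dist c x y ∧ z = c ((1 - a) * dist x y)

/-- Convexity of a function with values in `(-∞, ∞]`, regarded as an extended real function
omitting `⊥`. -/
def IsConvexFun (f : X → EReal) : Prop :=
  ∀ x y z : X, ∀ a ∈ Ioo (0 : ℝ) 1, IsConvexComb a x y z →
    f z ≤ (a : EReal) * f x + ((1 - a : ℝ) : EReal) * f y

/-- Proper lower semicontinuous convex functions of `X` into `(-∞, ∞]`. -/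
structure IsProperLscConvex (f : X → EReal) : Prop where
  ne_bot : ∀ x, f x ≠ ⊥
  proper : ∃ x, f x ≠ ⊤
  lsc : LowerSemicontinuous f
  convex : IsConvexFun f

/-- The set of all minimizers of `f` over the whole space. -/
def argmin (f : X → EReal) : Set X := {u | IsMinOn f univ u}

/-- The function `y ↦ f y + (1/η) tan (√κ d(y, x)) sin (√κ d(y, x))`. -/
def proxObjective (κ : ℝ) (f : X → EReal) (η : ℝ) (x y : X) : EReal :=
  f y + ((1 / η * (Real.tan (√κ * dist y x) * Real.sin (√κ * dist y x)) : ℝ) : EReal)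

open Classical in
/-- The resolvent of `η f` at `x`: the minimizer of `proxObjective κ f η x`. (If there were no
minimizer its value would be `x`.) -/
def proxResolvent (κ : ℝ) (f : X → EReal) (η : ℝ) (x : X) : X :=
  if h : (argmin (proxObjective κ f η x)).Nonempty then h.some else x

/-- `limsup_n d(y, x_n)`. This is used for bounded sequences only, where the real-valued limsup
is the genuine one. -/
def limsupDist (x : ℕ → X) (y : X) : ℝ := limsup (fun n => dist y (x n)) atTop

/-- The asymptotic radius `inf_y limsup_n d(y, x_n)`. -/
def asympRadius (x : ℕ → X) : ℝ := ⨅ y, limsupDist x y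

/-- The asymptotic center of a (bounded) sequence. -/
def asympCenter (x : ℕ → X) : Set X := {z | limsupDist x z = asympRadius x}

/-- Δ-convergence of a (bounded) sequence: every subsequence has asymptotic center `{p}`. -/
def DeltaConverges (x : ℕ → X) (p : X) : Prop :=
  ∀ φ : ℕ → ℕ, StrictMono φ → asympCenter (x ∘ φ) = {p}

end

end CATProx

end

open CATProx

section

open Real Set Filter Topology

/-! Everything is expressed through `cos (√κ * dist x y)`, positive because all distances stay below
a quarter great circle. Comparison with the sphere bounds this cosine from below along geodesics
(`IsCAT.halfSpherical`). At midpoints the bound has the extra factor `cos (√κ * dist x y / 2)`, a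
uniform concavity that replaces weak compactness: nested closed midpoint convex sets that all meet a
fixed ball of radius below `D_κ / 2` have a common point. This yields minimizers of `f`, resolvents
and asymptotic centers.

Since `tan t * sin t = 1 / cos t - cos t`, the penalty is a decreasing convex function of the
cosine. Differentiating the minimality of the resolvent `y` of `x` along the geodesic towards `z`
gives `resolvent_inequality`. If `f z ≤ f y`, it is a Pythagorean inequality, so the iteration is
Fejér monotone. If `f (y n)` stayed above `f z + ε`, the cosines of the distances from `x n` to `z`
would grow by a fixed multiple of `(1 - a n) * lam n`; the sum diverges, so `f (y n)` comes
arbitrarily close to the infimum. A bound on the asymptotic radius keeps late resolvents in one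
ball, so a minimizer exists.

When `a n` stays away from 1, the distances between `x n` and `y n` tend to 0. An asymptotic center
of a subsequence is then fixed by a resolvent, hence a minimizer, and convergence of the distances
to each minimizer makes all these centers equal. -/

/-! ### Spherical comparison -/

theorem cos_arccos_inner (u v : ModelSphere) :
    cos (arccos (inner ℝ (u : EuclideanSpace ℝ (Fin 3)) v)) =
      inner ℝ (u : EuclideanSpace ℝ (Fin 3)) v := by
  have h := abs_real_inner_le_norm (u : EuclideanSpace ℝ (Fin 3)) v
  have hu : ‖(u : EuclideanSpace ℝ (Fin 3))‖ = 1 := by simp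
  have hv : ‖(v : EuclideanSpace ℝ (Fin 3))‖ = 1 := by simp
  rw [hu, hv, one_mul, abs_le] at h
  exact cos_arccos h.1 h.2

/-- The great circle arc between two points of the sphere that are not antipodal. -/
theorem exists_sphere_geodesic {κ : ℝ} (hκ : 0 < κ) (u v : ModelSphere)
    (huv : √κ * modelDist κ u v < π) :
    ∃ c : ℝ → ModelSphere, IsGeodesicPath (modelDist κ) c u v ∧
      ∀ (s : ℝ) (w : ModelSphere), sin (√κ * modelDist κ u v) *
        inner ℝ (c s : EuclideanSpace ℝ (Fin 3)) (w : EuclideanSpace ℝ (Fin 3)) =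
        sin (√κ * modelDist κ u v - √κ * s) * inner ℝ (u : EuclideanSpace ℝ (Fin 3)) w +
        sin (√κ * s) * inner ℝ (v : EuclideanSpace ℝ (Fin 3)) w := by
  have hk : 0 < √κ := sqrt_pos.2 hκ
  have hd : ∀ a b : ModelSphere, √κ * modelDist κ a b =
      arccos (inner ℝ (a : EuclideanSpace ℝ (Fin 3)) b) := fun a b => by
    unfold modelDist; field_simp
  have hu : ‖(u : EuclideanSpace ℝ (Fin 3))‖ = 1 := by simp
  have hv : ‖(v : EuclideanSpace ℝ (Fin 3))‖ = 1 := by simp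
  have huu : inner ℝ (u : EuclideanSpace ℝ (Fin 3)) u = 1 := by
    rw [real_inner_self_eq_norm_sq, hu]; norm_num
  have hvv : inner ℝ (v : EuclideanSpace ℝ (Fin 3)) v = 1 := by
    rw [real_inner_self_eq_norm_sq, hv]; norm_num
  set θ := √κ * modelDist κ u v with hθ
  have hcos : inner ℝ (u : EuclideanSpace ℝ (Fin 3)) v = cos θ := by
    rw [hθ, hd, cos_arccos_inner]
  have hθ0 : 0 ≤ θ := by rw [hθ, hd]; exact arccos_nonneg _
  rcases hθ0.eq_or_lt with h0 | h0
  · have hm : modelDist κ u v = 0 := by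
      rcases mul_eq_zero.1 h0.symm with h | h
      · exact absurd h hk.ne'
      · exact h
    have huv' : u = v := by
      rw [← h0, cos_zero] at hcos
      exact Subtype.ext ((inner_eq_one_iff_of_norm_eq_one hu hv).1 hcos)
    subst huv'
    refine ⟨fun _ => u, ⟨rfl, rfl, ?_⟩, ?_⟩
    · intro s hs t ht
      rw [hm, Icc_self, mem_singleton_iff] at hs ht
      rw [hs, ht, hm]; simp
    · intro s w
      rw [← h0]; simp
  · have hsin : 0 < sin θ := sin_pos_of_pos_of_lt_pi h0 huv
    let e : ℝ → EuclideanSpace ℝ (Fin 3) := fun s =>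
      (sin (θ - √κ * s) / sin θ) • (u : EuclideanSpace ℝ (Fin 3)) +
        (sin (√κ * s) / sin θ) • (v : EuclideanSpace ℝ (Fin 3))
    have hee : ∀ s t, inner ℝ (e s) (e t) = cos (√κ * s - √κ * t) := by
      intro s t
      simp only [e, inner_add_left, inner_add_right, real_inner_smul_left, real_inner_smul_right,
        huu, hvv, hcos, real_inner_comm (u : EuclideanSpace ℝ (Fin 3)) (v : EuclideanSpace ℝ (Fin 3))]
      rw [sin_sub, sin_sub, cos_sub]
      field_simp
      linear_combination -(sin (√κ * s) * sin (√κ * t)) * sin_sq_add_cos_sq θ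
    have hen : ∀ s, ‖e s‖ = 1 := by
      intro s
      have := real_inner_self_eq_norm_sq (e s)
      rw [hee, sub_self, cos_zero] at this
      nlinarith [norm_nonneg (e s)]
    refine ⟨fun s => ⟨e s, by simpa using hen s⟩, ⟨?_, ?_, ?_⟩, ?_⟩
    · apply Subtype.ext
      simp [e, hsin.ne']
    · apply Subtype.ext
      simp [e, ← hθ, hsin.ne']
    · intro s hs t ht
      have h1 : √κ * s - √κ * t = √κ * (s - t) := by ring
      have h2 : √κ * |s - t| ≤ π := by
        have : |s - t| ≤ modelDist κ u v := by
          rw [abs_le]; constructor <;> linarith [hs.1, hs.2, ht.1, ht.2]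
        nlinarith
      show (1 / √κ) * arccos (inner ℝ (e s) (e t)) = _
      rw [hee, h1, ← cos_abs, abs_mul, abs_of_pos hk, arccos_cos (by positivity) h2]
      field_simp
    · intro s w
      show sin θ * inner ℝ (e s) _ = _
      simp only [e, inner_add_left, real_inner_smul_left]
      field_simp

/-- Comparison triangles on the unit sphere. -/
theorem exists_sphere_triangle {A B C : ℝ} (hA : 0 ≤ A) (hB : 0 ≤ B) (hC : 0 ≤ C)
    (hA' : A ≤ π / 2) (hB' : B ≤ π / 2) (hC' : C ≤ π / 2)
    (h1 : A ≤ B + C) (h2 : B ≤ A + C) (h3 : C ≤ A + B) :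
    ∃ u v w : ModelSphere, inner ℝ (u : EuclideanSpace ℝ (Fin 3)) v = cos A ∧
      inner ℝ (v : EuclideanSpace ℝ (Fin 3)) w = cos B ∧
      inner ℝ (u : EuclideanSpace ℝ (Fin 3)) w = cos C := by
  have hsA : 0 ≤ sin A := sin_nonneg_of_nonneg_of_le_pi hA (by linarith [pi_pos])
  have hsC : 0 ≤ sin C := sin_nonneg_of_nonneg_of_le_pi hC (by linarith [pi_pos])
  have hl : cos (A + C) ≤ cos B := cos_le_cos_of_nonneg_of_le_pi hB (by linarith) h2
  have hr : cos B ≤ cos (A - C) := by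
    rw [← cos_abs (A - C)]
    exact cos_le_cos_of_nonneg_of_le_pi (abs_nonneg _) (by linarith [pi_pos])
      (abs_le.2 ⟨by linarith, by linarith⟩)
  rw [cos_add] at hl
  rw [cos_sub] at hr
  -- By the law of cosines, `k` is the cosine of the angle at `u`; the triangle inequalities give
  -- `|k| ≤ 1`. If a side at `u` has length zero, the angle is arbitrary.
  obtain ⟨k, hk, hk1⟩ : ∃ k : ℝ, k * (sin A * sin C) = cos B - cos A * cos C ∧ k ^ 2 ≤ 1 := by
    rcases (mul_nonneg hsA hsC).eq_or_lt with h | h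
    · exact ⟨0, by linarith, by norm_num⟩
    · refine ⟨(cos B - cos A * cos C) / (sin A * sin C), div_mul_cancel₀ _ h.ne', ?_⟩
      rw [sq_le_one_iff_abs_le_one, abs_div, abs_of_pos h, div_le_one h, abs_le]
      constructor <;> linarith
  have hq : √(1 - k ^ 2) ^ 2 = 1 - k ^ 2 := sq_sqrt (by linarith)
  refine ⟨⟨!₂[1, 0, 0], ?_⟩, ⟨!₂[cos A, sin A, 0], ?_⟩,
    ⟨!₂[cos C, sin C * k, sin C * √(1 - k ^ 2)], ?_⟩, ?_, ?_, ?_⟩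
  · simp [EuclideanSpace.norm_eq, Fin.sum_univ_three]
  · simp [EuclideanSpace.norm_eq, Fin.sum_univ_three]
  · have : cos C ^ 2 + (sin C * k) ^ 2 + (sin C * √(1 - k ^ 2)) ^ 2 = 1 := by
      rw [mul_pow, mul_pow, hq]; linear_combination sin_sq_add_cos_sq C
    simp [EuclideanSpace.norm_eq, Fin.sum_univ_three, this]
  · simp [PiLp.inner_apply, Fin.sum_univ_three]
  · simp [PiLp.inner_apply, Fin.sum_univ_three]
    linarith
  · simp [PiLp.inner_apply, Fin.sum_univ_three]

/-- A uniquely geodesic space of radius less than that of a hemisphere of the sphere of radius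
`1 / k`, whose triangles are at most as thick as those of this sphere. -/
structure HalfSpherical (k : ℝ) (X : Type*) [MetricSpace X] : Prop where
  pos : 0 < k
  lt (x y : X) : k * dist x y < π / 2
  exists_comb (x y : X) (a : ℝ) : ∃ z, IsConvexComb a x y z
  cos_le {x y z : X} {a : ℝ} (ha : a ∈ Icc (0 : ℝ) 1) (hz : IsConvexComb a x y z) (w : X) :
    sin (a * (k * dist x y)) * cos (k * dist x w) +
      sin ((1 - a) * (k * dist x y)) * cos (k * dist y w) ≤
      sin (k * dist x y) * cos (k * dist z w)

/-- The sole use of the comparison axiom. On the sphere the cosine inequality is an identity for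
points of a great circle arc; comparison only shortens the distance from `z` to `w`, so it increases
the cosine. -/
theorem CATProx.IsCAT.halfSpherical {X : Type*} [MetricSpace X] {κ : ℝ} (hκ : 0 < κ) (hX : IsCAT κ X)
    (hdiam : ∀ w w' : X, dist w w' < diamModel κ / 2) : HalfSpherical (√κ) X := by
  have hk : 0 < √κ := sqrt_pos.2 hκ
  have hlt : ∀ x y : X, √κ * dist x y < π / 2 := by
    intro x y
    have := hdiam x y
    unfold diamModel at this
    rw [div_div, lt_div_iff₀ (by positivity)] at this
    linarith
  have hD : 0 < diamModel κ := by unfold diamModel; positivity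
  have hgeo : ∀ x y : X, ∃ c : ℝ → X, IsGeodesicPath dist c x y := fun x y =>
    hX.geodesic x y (by linarith [hdiam x y])
  refine ⟨hk, hlt, ?_, ?_⟩
  · intro x y a
    obtain ⟨c, hc⟩ := hgeo x y
    exact ⟨_, c, hc, rfl⟩
  · rintro x y z a ha ⟨c, hc, rfl⟩ w
    obtain ⟨c₁, hc₁⟩ := hgeo y w
    obtain ⟨c₂, hc₂⟩ := hgeo w x
    have t1 := dist_triangle x w y
    have t2 := dist_triangle y x w
    have t3 := dist_triangle x y w
    rw [dist_comm w y] at t1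
    rw [dist_comm y x] at t2
    obtain ⟨u, v, p, huv, hvp, hup⟩ := exists_sphere_triangle
      (A := √κ * dist x y) (B := √κ * dist y w) (C := √κ * dist x w)
      (by positivity) (by positivity) (by positivity) (hlt _ _).le (hlt _ _).le (hlt _ _).le
      (by nlinarith) (by nlinarith) (by nlinarith)
    have hmd : ∀ (r s : X) (b b' : ModelSphere),
        inner ℝ (b : EuclideanSpace ℝ (Fin 3)) b' = cos (√κ * dist r s) →
        modelDist κ b b' = dist r s := by
      intro r s b b' h
      unfold modelDist
      rw [h, arccos_cos (by positivity) (by linarith [hlt r s, pi_pos])]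
      field_simp
    have hself : ∀ b : ModelSphere, modelDist κ b b = 0 := by
      intro b
      have hb : ‖(b : EuclideanSpace ℝ (Fin 3))‖ = 1 := by simp
      unfold modelDist
      rw [real_inner_self_eq_norm_sq, hb]; simp
    have hsymm : ∀ b b' : ModelSphere, modelDist κ b b' = modelDist κ b' b := by
      intro b b'; unfold modelDist; rw [real_inner_comm]
    have duv := hmd x y u v huv
    have dvp := hmd y w v p hvp
    have dup := hmd x w u p hup
    have hsm : ∀ r s : X, √κ * dist r s < π := fun r s => by linarith [hlt r s, pi_pos]
    obtain ⟨g₀, hg₀, hg₀'⟩ := exists_sphere_geodesic hκ u v (by rw [duv]; exact hsm _ _)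
    obtain ⟨g₁, hg₁, -⟩ := exists_sphere_geodesic hκ v p (by rw [dvp]; exact hsm _ _)
    obtain ⟨g₂, hg₂, -⟩ := exists_sphere_geodesic hκ p u
      (by rw [hsymm, dup]; exact hsm _ _)
    have hs : (1 - a) * dist x y ∈ Icc (0 : ℝ) (dist x y) :=
      ⟨mul_nonneg (by linarith [ha.2]) dist_nonneg,
        by nlinarith [ha.1, dist_nonneg (x := x) (y := y)]⟩
    -- The point `z` lies on side 0; the vertex `w` enters as the far end of side 1.
    have key := hX.comparison ![x, y, w] ![c, c₁, c₂] ![u, v, p] ![g₀, g₁, g₂]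
      (by simp; linarith [hdiam x y, hdiam y w, hdiam w x])
      (by intro i; fin_cases i <;> simpa)
      (by
        intro i j
        fin_cases i <;> fin_cases j <;>
          simp [hself, duv, dvp, dup, hsymm v u, hsymm p v, hsymm p u, dist_comm])
      (by intro i; fin_cases i <;> simpa) 0 1
      (c ((1 - a) * dist x y)) ⟨_, hs, rfl⟩
      (g₀ ((1 - a) * dist x y)) ⟨_, by simpa [duv] using hs, rfl⟩
      (by
        have e1 := hc.2.2 0 ⟨le_rfl, dist_nonneg⟩ _ hs
        have e2 := hg₀.2.2 0 ⟨le_rfl, by rw [duv]; exact dist_nonneg⟩ _ (by rw [duv]; exact hs)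
        rw [hc.1] at e1
        rw [hg₀.1] at e2
        simpa using e1.trans e2.symm)
      w ⟨dist y w, by simp, hc₁.2.1⟩
      p ⟨modelDist κ v p, by simp [dvp], hg₁.2.1⟩
      (by simp [dvp])
    have hf := hg₀' ((1 - a) * dist x y) p
    rw [duv, hup, hvp] at hf
    have h3 : cos (arccos (inner ℝ (g₀ ((1 - a) * dist x y) : EuclideanSpace ℝ (Fin 3)) p)) ≤
        cos (√κ * dist (c ((1 - a) * dist x y)) w) := by
      refine cos_le_cos_of_nonneg_of_le_pi (by positivity) (arccos_le_pi _) ?_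
      unfold modelDist at key
      calc _ ≤ √κ * _ := mul_le_mul_of_nonneg_left key hk.le
        _ = _ := by field_simp
    rw [cos_arccos_inner] at h3
    have hsn : 0 ≤ sin (√κ * dist x y) :=
      sin_nonneg_of_nonneg_of_le_pi (by positivity) (hsm x y).le
    calc _ = sin (√κ * dist x y) * inner ℝ
          (g₀ ((1 - a) * dist x y) : EuclideanSpace ℝ (Fin 3)) (p : EuclideanSpace ℝ (Fin 3)) := by
          rw [hf]; ring_nf
      _ ≤ _ := mul_le_mul_of_nonneg_left h3 hsn

theorem mul_sin_le_sin_mul {a D : ℝ} (ha : a ∈ Icc (0 : ℝ) 1) (hD : 0 ≤ D) (hD' : D ≤ π) :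
    a * sin D ≤ sin (a * D) := by
  have h := strictConcaveOn_sin_Icc.concaveOn.2 (x := D) (y := 0) ⟨hD, hD'⟩ ⟨le_rfl, pi_pos.le⟩
    ha.1 (sub_nonneg.2 ha.2) (by ring)
  simpa using h

/-- The harmonic-arithmetic mean inequality bounds `1 / c` by `e` times the average of `1 / c₁` and
`1 / c₂`. That average is at least 1, so the factor `e` becomes the additive gain `1 - e`. This
transfers concavity of the cosine to convexity of the penalty. -/
theorem inv_sub_self_le_of_add_le {c₁ c₂ c e : ℝ} (h₁ : 0 < c₁) (h₂ : 0 < c₂) (h₁' : c₁ ≤ 1)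
    (h₂' : c₂ ≤ 1) (hc : 0 < c) (he : e ≤ 1) (h : c₁ + c₂ ≤ 2 * e * c) :
    1 / c - c ≤ ((1 / c₁ - c₁) + (1 / c₂ - c₂)) / 2 - (1 - e) := by
  have he0 : 0 < e := by
    by_contra hn
    nlinarith
  have h3 : (c₁ + c₂) / 2 ≤ c := by nlinarith
  have h4 : 1 / c ≤ e * (2 / (c₁ + c₂)) := by
    rw [div_le_iff₀ hc]
    have : e * (2 / (c₁ + c₂)) * c = 2 * e * c / (c₁ + c₂) := by ring
    rw [this, le_div_iff₀ (by positivity)]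
    linarith
  have h5 : 2 / (c₁ + c₂) ≤ (1 / c₁ + 1 / c₂) / 2 := by
    rw [div_add_div _ _ h₁.ne' h₂.ne', div_div, div_le_div_iff₀ (by positivity) (by positivity)]
    nlinarith [sq_nonneg (c₁ - c₂)]
  have h6 : 1 ≤ 1 / c₁ := by rwa [le_div_iff₀ h₁, one_mul]
  have h7 : 1 ≤ 1 / c₂ := by rwa [le_div_iff₀ h₂, one_mul]
  nlinarith [mul_le_mul_of_nonneg_left h5 he0.le]

namespace CATProx

theorem IsConvexComb.dist_left {X : Type*} [MetricSpace X] {x y z : X} {a : ℝ}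
    (h : IsConvexComb a x y z) (ha : a ∈ Icc (0 : ℝ) 1) : dist x z = (1 - a) * dist x y := by
  obtain ⟨c, hc, rfl⟩ := h
  have hs : (1 - a) * dist x y ∈ Icc (0 : ℝ) (dist x y) :=
    ⟨mul_nonneg (by linarith [ha.2]) dist_nonneg,
      by nlinarith [ha.1, dist_nonneg (x := x) (y := y)]⟩
  have e := hc.2.2 0 ⟨le_rfl, dist_nonneg⟩ _ hs
  rw [hc.1, zero_sub, abs_neg, abs_of_nonneg hs.1] at e
  exact e

theorem IsConvexComb.dist_right {X : Type*} [MetricSpace X] {x y z : X} {a : ℝ}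
    (h : IsConvexComb a x y z) (ha : a ∈ Icc (0 : ℝ) 1) : dist z y = a * dist x y := by
  obtain ⟨c, hc, rfl⟩ := h
  have hs : (1 - a) * dist x y ∈ Icc (0 : ℝ) (dist x y) :=
    ⟨mul_nonneg (by linarith [ha.2]) dist_nonneg,
      by nlinarith [ha.1, dist_nonneg (x := x) (y := y)]⟩
  have e := hc.2.2 _ hs (dist x y) ⟨dist_nonneg, le_rfl⟩
  rw [hc.2.1, abs_sub_comm, abs_of_nonneg (by linarith [hs.2])] at e
  linarith

end CATProx

/-! ### Uniform concavity of the cosine and its compactness substitute -/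

namespace HalfSpherical

variable {X : Type*} [MetricSpace X] {k : ℝ}

theorem nonneg (H : HalfSpherical k X) (x y : X) : 0 ≤ k * dist x y :=
  mul_nonneg H.pos.le dist_nonneg

theorem cos_pos (H : HalfSpherical k X) (x y : X) : 0 < cos (k * dist x y) :=
  cos_pos_of_mem_Ioo ⟨by linarith [H.nonneg x y, pi_pos], H.lt x y⟩

theorem sin_pos (H : HalfSpherical k X) {x y : X} (h : x ≠ y) : 0 < sin (k * dist x y) :=
  sin_pos_of_pos_of_lt_pi (mul_pos H.pos (dist_pos.2 h)) (by linarith [H.lt x y, pi_pos])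

theorem cos_le_cos_iff (H : HalfSpherical k X) {x y z w : X} :
    cos (k * dist x y) ≤ cos (k * dist z w) ↔ dist z w ≤ dist x y := by
  rw [strictAntiOn_cos.le_iff_ge ⟨H.nonneg x y, by linarith [H.lt x y, pi_pos]⟩
    ⟨H.nonneg z w, by linarith [H.lt z w, pi_pos]⟩, mul_le_mul_iff_right₀ H.pos]

theorem mid_le (H : HalfSpherical k X) {x y z : X} (hz : IsConvexComb (1 / 2) x y z) (w : X) :
    cos (k * dist x w) + cos (k * dist y w) ≤
      2 * cos (k * dist x y / 2) * cos (k * dist z w) := by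
  have ha : (1 / 2 : ℝ) ∈ Icc (0 : ℝ) 1 := by norm_num
  rcases eq_or_ne x y with rfl | hxy
  · have h := hz.dist_left ha
    rw [dist_self, mul_zero, dist_eq_zero] at h
    subst h
    simp; linarith
  · have h := H.cos_le ha hz w
    have e1 : (1 / 2 : ℝ) * (k * dist x y) = k * dist x y / 2 := by ring
    have e2 : (1 - 1 / 2 : ℝ) * (k * dist x y) = k * dist x y / 2 := by ring
    have e3 : sin (k * dist x y) = 2 * sin (k * dist x y / 2) * cos (k * dist x y / 2) := by
      rw [← sin_two_mul]; ring_nf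
    have hs : 0 < sin (k * dist x y / 2) :=
      sin_pos_of_pos_of_lt_pi (half_pos (mul_pos H.pos (dist_pos.2 hxy)))
        (by linarith [H.lt x y, pi_pos])
    rw [e1, e2, e3] at h
    refine le_of_mul_le_mul_left ?_ hs
    linarith

theorem comb_le (H : HalfSpherical k X) {x y z : X} {a : ℝ} (ha : a ∈ Icc (0 : ℝ) 1)
    (hz : IsConvexComb a x y z) (w : X) :
    a * cos (k * dist x w) + (1 - a) * cos (k * dist y w) ≤ cos (k * dist z w) := by
  rcases eq_or_ne x y with rfl | hxy
  · have h := hz.dist_left ha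
    rw [dist_self, mul_zero, dist_eq_zero] at h
    subst h
    linarith
  · have hs := H.sin_pos hxy
    refine le_of_mul_le_mul_left ?_ hs
    refine le_trans ?_ (H.cos_le ha hz w)
    have hπ : k * dist x y ≤ π := by linarith [H.lt x y, pi_pos]
    have h1 := mul_le_mul_of_nonneg_right (mul_sin_le_sin_mul ha (H.nonneg x y) hπ)
      (H.cos_pos x w).le
    have h2 := mul_le_mul_of_nonneg_right
      (mul_sin_le_sin_mul (a := 1 - a) ⟨by linarith [ha.2], by linarith [ha.1]⟩ (H.nonneg x y) hπ)
      (H.cos_pos y w).le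
    linarith

theorem dist_comb_le (H : HalfSpherical k X) {x y z w : X} {a r : ℝ} (ha : a ∈ Icc (0 : ℝ) 1)
    (hz : IsConvexComb a x y z) (hx : dist x w ≤ r) (hy : dist y w ≤ r) : dist z w ≤ r := by
  have h := H.comb_le ha hz w
  rcases le_total (dist x w) (dist y w) with hd | hd
  · refine le_trans (H.cos_le_cos_iff.1 (le_trans ?_ h)) hy
    nlinarith [H.cos_le_cos_iff.2 hd, ha.1]
  · refine le_trans (H.cos_le_cos_iff.1 (le_trans ?_ h)) hx
    nlinarith [H.cos_le_cos_iff.2 hd, ha.2]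

/-- Converts a midpoint factor close to 1 into a small distance: `1 - cos (t / 2) = 2 * sin (t / 4)
^ 2`, and Jordan's inequality bounds the sine below. -/
theorem sq_dist_le (H : HalfSpherical k X) (x y : X) :
    dist x y ^ 2 ≤ 2 * π ^ 2 / k ^ 2 * (1 - cos (k * dist x y / 2)) := by
  have hk := H.pos
  have h0 := H.nonneg x y
  have h := mul_le_sin (x := k * dist x y / 4) (by linarith) (by linarith [H.lt x y, pi_pos])
  have h1 : cos (k * dist x y / 2) = 1 - 2 * sin (k * dist x y / 4) ^ 2 := by
    rw [show k * dist x y / 2 = 2 * (k * dist x y / 4) by ring, cos_two_mul, cos_sq']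
    ring
  have h2 := pow_le_pow_left₀ (by positivity) h 2
  have h3 : 2 / π * (k * dist x y / 4) = k * dist x y / (2 * π) := by field_simp; ring
  rw [h3] at h2
  calc dist x y ^ 2 = 2 * π ^ 2 / k ^ 2 * (2 * (k * dist x y / (2 * π)) ^ 2) := by field_simp
    _ ≤ _ := by
      rw [h1]
      refine mul_le_mul_of_nonneg_left ?_ (by positivity)
      linarith

/-- Cantor's intersection theorem for midpoint convex sets that stay, in the sense of a
uniformly concave function `c`, away from the boundary of a hemisphere. -/
theorem nonempty_iInter [CompleteSpace X] (H : HalfSpherical k X) (c : X → ℝ)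
    (hc : ∀ x y z, IsConvexComb (1 / 2) x y z → c x + c y ≤ 2 * cos (k * dist x y / 2) * c z)
    (hc1 : ∀ x, c x ≤ 1) (C : ℕ → Set X) (hanti : Antitone C) (hclosed : ∀ n, IsClosed (C n))
    (hmid : ∀ n x y z, x ∈ C n → y ∈ C n → IsConvexComb (1 / 2) x y z → z ∈ C n)
    {c₀ : ℝ} (hc₀ : 0 < c₀) (hne : ∀ n, ∃ y ∈ C n, c₀ ≤ c y) : (⋂ n, C n).Nonempty := by
  have hbdd : ∀ n, BddAbove (c '' C n) := fun n => ⟨1, by rintro _ ⟨y, -, rfl⟩; exact hc1 y⟩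
  set S : ℕ → ℝ := fun n => sSup (c '' C n) with hS
  have hle : ∀ n, ∀ y ∈ C n, c y ≤ S n := fun n y hy => le_csSup (hbdd n) ⟨y, hy, rfl⟩
  have hS0 : ∀ n, c₀ ≤ S n := fun n => by
    obtain ⟨y, hy, h⟩ := hne n
    exact h.trans (hle n y hy)
  have hSanti : Antitone S := fun n m hnm => by
    obtain ⟨y, hy, -⟩ := hne m
    exact csSup_le_csSup (hbdd n) ⟨_, y, hy, rfl⟩ (image_mono (hanti hnm))
  have hSbdd : BddBelow (range S) := ⟨c₀, by rintro _ ⟨n, rfl⟩; exact hS0 n⟩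
  have hSlim := tendsto_atTop_ciInf hSanti hSbdd
  set L := ⨅ n, S n
  have hL : ∀ n, L ≤ S n := fun n => ciInf_le hSbdd n
  have hex : ∀ n : ℕ, ∃ y ∈ C n, S n - 1 / ((n : ℝ) + 1) < c y := fun n => by
    obtain ⟨y₀, hy₀, -⟩ := hne n
    obtain ⟨_, ⟨y, hy, rfl⟩, h⟩ := exists_lt_of_lt_csSup (s := c '' C n) ⟨_, y₀, hy₀, rfl⟩
      (show S n - 1 / ((n : ℝ) + 1) < S n by
        have : 0 < 1 / ((n : ℝ) + 1) := by positivity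
        linarith)
    exact ⟨y, hy, h⟩
  choose y hyC hy using hex
  -- The midpoint of `y n` and `y m` lies in `C n`, so its value is at most `S n`. With `e` the
  -- midpoint factor, this forces `2 * (1 - e) * S n ≤ S n - L + 2 / (n + 1)`; then `c₀ ≤ S n` and
  -- `sq_dist_le` give the bound.
  set b : ℕ → ℝ := fun n =>
    √(2 * π ^ 2 / k ^ 2 * ((S n - L + 2 * (1 / ((n : ℝ) + 1))) / (2 * c₀))) with hb
  have hbound : ∀ n m : ℕ, n ≤ m → dist (y n) (y m) ≤ b n := by
    intro n m hnm
    obtain ⟨z, hz⟩ := H.exists_comb (y n) (y m) (1 / 2)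
    have hzC := hmid n _ _ _ (hyC n) (hanti hnm (hyC m)) hz
    have h1 := hc _ _ _ hz
    have h2 := hle n z hzC
    have h3 : 1 / ((m : ℝ) + 1) ≤ 1 / ((n : ℝ) + 1) := by
      apply one_div_le_one_div_of_le (by positivity)
      have : (n : ℝ) ≤ m := by exact_mod_cast hnm
      linarith
    have h4 : 0 ≤ cos (k * dist (y n) (y m) / 2) :=
      cos_nonneg_of_mem_Icc ⟨by linarith [H.nonneg (y n) (y m), pi_pos],
        by linarith [H.lt (y n) (y m), H.nonneg (y n) (y m)]⟩
    have h4' := cos_le_one (k * dist (y n) (y m) / 2)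
    have h5 := mul_le_mul_of_nonneg_left h2 h4
    have h6 : 1 - cos (k * dist (y n) (y m) / 2) ≤
        (S n - L + 2 * (1 / ((n : ℝ) + 1))) / (2 * c₀) := by
      rw [le_div_iff₀ (by positivity)]
      have h7 := mul_le_mul_of_nonneg_left (hS0 n) (sub_nonneg.2 h4')
      linarith [hy n, hy m, hL m]
    apply le_sqrt_of_sq_le
    exact (H.sq_dist_le _ _).trans (mul_le_mul_of_nonneg_left h6 (by positivity))
  have hlim : Tendsto b atTop (nhds 0) := by
    have h1 : Tendsto (fun n : ℕ => 2 * π ^ 2 / k ^ 2 *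
        ((S n - L + 2 * (1 / ((n : ℝ) + 1))) / (2 * c₀))) atTop
        (nhds (2 * π ^ 2 / k ^ 2 * ((L - L + 2 * 0) / (2 * c₀)))) :=
      (((hSlim.sub_const L).add
        (tendsto_one_div_add_atTop_nhds_zero_nat.const_mul 2)).div_const _).const_mul _
    have h2 := h1.sqrt
    rwa [sub_self, mul_zero, add_zero, zero_div, mul_zero, sqrt_zero] at h2
  obtain ⟨p, hp⟩ := cauchySeq_tendsto_of_complete (cauchySeq_of_le_tendsto_0' b hbound hlim)
  refine ⟨p, mem_iInter.2 fun n => (hclosed n).mem_of_tendsto hp ?_⟩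
  filter_upwards [eventually_ge_atTop n] with m hm using hanti hm (hyC m)

/-- Existence of minimizers of quasiconvex lower semicontinuous functions. -/
theorem argmin_nonempty [CompleteSpace X] (H : HalfSpherical k X) (g : X → EReal)
    (hg : LowerSemicontinuous g)
    (hmid : ∀ x y z r, g x ≤ r → g y ≤ r → IsConvexComb (1 / 2) x y z → g z ≤ r) (p : X)
    {c₀ : ℝ} (hc₀ : 0 < c₀)
    (hne : ∀ r, ⨅ y, g y < r → ∃ y, g y ≤ r ∧ c₀ ≤ cos (k * dist y p)) :
    (argmin g).Nonempty := by
  rcases eq_or_ne (⨅ y, g y) ⊤ with h | h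
  · exact ⟨p, fun y _ => by simp [iInf_eq_top.1 h]⟩
  · obtain ⟨u, hu, huI, hlim⟩ := exists_seq_strictAnti_tendsto' (lt_top_iff_ne_top.2 h)
    obtain ⟨q, hq⟩ := H.nonempty_iInter (fun y => cos (k * dist y p))
      (fun x y z hz => H.mid_le hz p) (fun x => cos_le_one _) (fun n => g ⁻¹' Iic (u n))
      (fun n m hnm => preimage_mono (Iic_subset_Iic.2 (hu.antitone hnm)))
      (fun n => lowerSemicontinuous_iff_isClosed_preimage.1 hg _)
      (fun n x y z hx hy hz => hmid x y z _ hx hy hz) hc₀ (fun n => hne _ (huI n).1)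
    rw [mem_iInter] at hq
    have hqI : g q ≤ ⨅ y, g y := ge_of_tendsto' hlim hq
    exact ⟨q, fun y _ => hqI.trans (iInf_le _ y)⟩

end HalfSpherical

theorem EReal.add_coe_le_coe_iff {a : EReal} {b c : ℝ} :
    a + (b : EReal) ≤ (c : EReal) ↔ a ≤ ((c - b : ℝ) : EReal) := by
  induction a with
  | bot => simp
  | top =>
    rw [EReal.top_add_coe, top_le_iff, top_le_iff]
    exact iff_of_false (EReal.coe_ne_top _) (EReal.coe_ne_top _)
  | coe a =>
    rw [← EReal.coe_add, EReal.coe_le_coe_iff, EReal.coe_le_coe_iff]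
    exact _root_.le_sub_iff_add_le.symm

/-! ### Convex functions on the space -/

namespace CATProx

variable {X : Type*} [MetricSpace X] {κ : ℝ} {f : X → EReal}

theorem IsProperLscConvex.le_of_isConvexComb (hf : IsProperLscConvex f) {x y z : X} {a u v : ℝ}
    (ha : a ∈ Ioo (0 : ℝ) 1) (hz : IsConvexComb a x y z) (hx : f x ≤ (u : EReal))
    (hy : f y ≤ (v : EReal)) : f z ≤ ((a * u + (1 - a) * v : ℝ) : EReal) := by
  refine (hf.convex x y z a ha hz).trans ?_
  push_cast
  have h1 : (0 : EReal) ≤ (a : EReal) := by exact_mod_cast ha.1.le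
  have h2 : (0 : EReal) ≤ ((1 - a : ℝ) : EReal) := by exact_mod_cast (sub_pos.2 ha.2).le
  have := add_le_add (mul_le_mul_of_nonneg_left hx h1) (mul_le_mul_of_nonneg_left hy h2)
  simpa using this

theorem IsProperLscConvex.mid_le (hf : IsProperLscConvex f) {x y z : X} {u v : ℝ}
    (hz : IsConvexComb (1 / 2) x y z) (hx : f x ≤ (u : EReal))
    (hy : f y ≤ (v : EReal)) : f z ≤ (((u + v) / 2 : ℝ) : EReal) := by
  have h := hf.le_of_isConvexComb (by norm_num) hz hx hy
  convert h using 2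
  ring

theorem IsProperLscConvex.sublevel_mid (hf : IsProperLscConvex f) {x y z : X} {r : EReal}
    (hx : f x ≤ r) (hy : f y ≤ r) (hz : IsConvexComb (1 / 2) x y z) : f z ≤ r := by
  induction r with
  | top => exact le_top
  | bot => exact absurd (le_bot_iff.1 hx) (hf.ne_bot x)
  | coe r => simpa using hf.mid_le hz hx hy

/-- A convex function on a subset of an open hemisphere is bounded below. -/
theorem IsProperLscConvex.exists_le [CompleteSpace X] {k : ℝ} (H : HalfSpherical k X)
    (hf : IsProperLscConvex f) : ∃ m : ℝ, ∀ y, (m : EReal) ≤ f y := by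
  by_contra hcon
  push Not at hcon
  obtain ⟨p, hp⟩ := hf.proper
  have hpv : f p = ((f p).toReal : EReal) := (EReal.coe_toReal hp (hf.ne_bot p)).symm
  obtain ⟨u, hu⟩ := H.argmin_nonempty f hf.lsc (fun x y z r => hf.sublevel_mid) p
    (c₀ := cos (π / 4)) (cos_pos_of_mem_Ioo ⟨by linarith [pi_pos], by linarith [pi_pos]⟩) (by
      intro r hr
      have hself : cos (π / 4) ≤ cos (k * dist p p) := by
        rw [dist_self, mul_zero, cos_zero]; exact cos_le_one _
      induction r with
      | bot => exact absurd hr (not_lt_bot)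
      | top => exact ⟨p, le_top, hself⟩
      | coe r =>
        -- The value at `y` is so low that the midpoint with `p` has value at most `r`. That
        -- midpoint is within angle `π / 4` of `p`, so all sublevel sets meet one ball and `f` would
        -- attain its infimum.
        obtain ⟨y, hy⟩ := hcon (2 * r - (f p).toReal)
        obtain ⟨z, hz⟩ := H.exists_comb p y (1 / 2)
        have h := hf.mid_le hz hpv.le hy.le
        refine ⟨z, by simpa using h, ?_⟩
        have hd := hz.dist_left (by norm_num)
        rw [dist_comm z p, hd]
        refine cos_le_cos_of_nonneg_of_le_pi ?_ (by linarith [pi_pos]) ?_ <;>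
          linarith [H.nonneg p y, H.lt p y])
  obtain ⟨y, hy⟩ := hcon (f u).toReal
  have h1 : f u ≤ f y := hu (mem_univ y)
  have h2 : f u ≠ ⊤ := (h1.trans_lt (hy.trans (EReal.coe_lt_top _))).ne
  rw [EReal.coe_toReal h2 (hf.ne_bot u)] at hy
  exact absurd h1 (not_le.2 hy)

end CATProx

theorem Real.tan_mul_sin_eq {t : ℝ} (ht : cos t ≠ 0) : tan t * sin t = 1 / cos t - cos t := by
  rw [tan_eq_sin_div_cos]
  field_simp
  linear_combination sin_sq_add_cos_sq t

/-! ### Existence and uniqueness of the resolvent -/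

namespace CATProx

variable {X : Type*} [MetricSpace X] {κ : ℝ} {f : X → EReal}

theorem proxObjective_eq (H : HalfSpherical (√κ) X) (f : X → EReal) (η : ℝ) (x y : X) :
    proxObjective κ f η x y =
      f y + ((1 / η * (1 / cos (√κ * dist y x) - cos (√κ * dist y x)) : ℝ) : EReal) := by
  rw [proxObjective, tan_mul_sin_eq (H.cos_pos y x).ne']

/-- The penalty is uniformly convex. Existence of the resolvent needs only the resulting
quasiconvexity; uniqueness needs the gain. -/
theorem proxObjective_mid_le (H : HalfSpherical (√κ) X) (hf : IsProperLscConvex f) {η : ℝ}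
    (hη : 0 < η) {x y y' z : X} {r s : ℝ} (hz : IsConvexComb (1 / 2) y y' z)
    (hy : proxObjective κ f η x y ≤ (r : EReal)) (hy' : proxObjective κ f η x y' ≤ (s : EReal)) :
    proxObjective κ f η x z ≤
      (((r + s) / 2 - 1 / η * (1 - cos (√κ * dist y y' / 2)) : ℝ) : EReal) := by
  rw [proxObjective_eq H, EReal.add_coe_le_coe_iff] at *
  refine (hf.mid_le hz hy hy').trans ?_
  rw [EReal.coe_le_coe_iff]
  have h := inv_sub_self_le_of_add_le (H.cos_pos y x) (H.cos_pos y' x) (cos_le_one _)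
    (cos_le_one _) (H.cos_pos z x) (cos_le_one _) (H.mid_le hz x)
  have h1 := mul_le_mul_of_nonneg_left h (one_div_pos.2 hη).le
  linarith

theorem proxObjective_lsc (H : HalfSpherical (√κ) X) (hf : IsProperLscConvex f) (η : ℝ) (x : X) :
    LowerSemicontinuous (proxObjective κ f η x) := by
  have h : proxObjective κ f η x = fun y =>
      f y + ((1 / η * (1 / cos (√κ * dist y x) - cos (√κ * dist y x)) : ℝ) : EReal) :=
    funext fun y => proxObjective_eq H f η x y
  rw [h]
  refine hf.lsc.add' (Continuous.lowerSemicontinuous ?_) fun y =>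
    EReal.continuousAt_add (Or.inr (EReal.coe_ne_bot _)) (Or.inr (EReal.coe_ne_top _))
  refine continuous_coe_real_ereal.comp ?_
  have hc : Continuous fun y => cos (√κ * dist y x) := by fun_prop
  exact continuous_const.mul ((continuous_const.div hc fun y => (H.cos_pos y x).ne').sub hc)

theorem argmin_proxObjective_nonempty [CompleteSpace X] (H : HalfSpherical (√κ) X)
    (hf : IsProperLscConvex f) {η : ℝ} (hη : 0 < η) (x : X) :
    (argmin (proxObjective κ f η x)).Nonempty := by
  obtain ⟨m, hm⟩ := hf.exists_le H
  obtain ⟨p, hp⟩ := hf.proper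
  set c := fun y => cos (√κ * dist y x)
  have hpv : proxObjective κ f η x p =
      (((f p).toReal + 1 / η * (1 / c p - c p) : ℝ) : EReal) := by
    rw [proxObjective_eq H, EReal.coe_add, EReal.coe_toReal hp (hf.ne_bot p)]
  set R := (f p).toReal + 1 / η * (1 / c p - c p)
  -- The lower bound `m` of `f` leaves at most `R - m` for the penalty, so `1 / c y ≤ c y + η * |R -
  -- m| ≤ 1 + η * |R - m|`.
  have hcR : ∀ y, proxObjective κ f η x y ≤ (R : EReal) → 1 / (1 + η * |R - m|) ≤ c y := by
    intro y hy
    rw [proxObjective_eq H, EReal.add_coe_le_coe_iff] at hy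
    have h1 := (hm y).trans hy
    rw [EReal.coe_le_coe_iff] at h1
    have h2 : 1 / η * (1 / c y - c y) ≤ |R - m| := by
      have := le_abs_self (R - m)
      linarith
    rw [one_div_mul_eq_div, div_le_iff₀ hη] at h2
    have hc : 0 < c y := H.cos_pos y x
    have hc1 : c y ≤ 1 := cos_le_one _
    rw [one_div_le (by positivity) hc]
    linarith
  refine H.argmin_nonempty _ (proxObjective_lsc H hf η x) ?_ x (c₀ := 1 / (1 + η * |R - m|))
    (by positivity) ?_
  · intro y y' z r hy hy' hz
    induction r with
    | top => exact le_top
    | bot =>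
      rw [proxObjective_eq H, le_bot_iff, EReal.add_eq_bot_iff] at hy
      exact absurd hy (not_or.2 ⟨hf.ne_bot y, EReal.coe_ne_bot _⟩)
    | coe r =>
      refine (proxObjective_mid_le H hf hη hz hy hy').trans ?_
      rw [EReal.coe_le_coe_iff]
      have := mul_nonneg (one_div_pos.2 hη).le (sub_nonneg.2 (cos_le_one (√κ * dist y y' / 2)))
      linarith
  · intro r hr
    obtain ⟨y, hy⟩ := iInf_lt_iff.1 hr
    rcases le_total (proxObjective κ f η x y) R with h | h
    · exact ⟨y, hy.le, hcR y h⟩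
    · exact ⟨p, hpv.le.trans (h.trans hy.le), hcR p hpv.le⟩

theorem ne_top_of_mem_argmin_proxObjective (H : HalfSpherical (√κ) X)
    (hf : IsProperLscConvex f) {η : ℝ} {x y : X}
    (hy : y ∈ argmin (proxObjective κ f η x)) : f y ≠ ⊤ := by
  obtain ⟨p, hp⟩ := hf.proper
  intro h
  have h1 : proxObjective κ f η x y ≤ proxObjective κ f η x p := hy (mem_univ p)
  rw [proxObjective_eq H, proxObjective_eq H, h, EReal.top_add_coe, top_le_iff] at h1
  rw [← EReal.coe_toReal hp (hf.ne_bot p), ← EReal.coe_add] at h1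
  exact EReal.coe_ne_top _ h1

theorem argmin_proxObjective_subsingleton (H : HalfSpherical (√κ) X)
    (hf : IsProperLscConvex f) {η : ℝ} (hη : 0 < η) (x : X) :
    (argmin (proxObjective κ f η x)).Subsingleton := by
  intro y hy y' hy'
  have hv : ∃ r : ℝ, proxObjective κ f η x y = r := by
    refine ⟨(f y).toReal + 1 / η * (1 / cos (√κ * dist y x) - cos (√κ * dist y x)), ?_⟩
    rw [proxObjective_eq H, EReal.coe_add,
      EReal.coe_toReal (ne_top_of_mem_argmin_proxObjective H hf hy) (hf.ne_bot y)]
  obtain ⟨r, hr⟩ := hv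
  obtain ⟨z, hz⟩ := H.exists_comb y y' (1 / 2)
  have h1 : proxObjective κ f η x y' ≤ (r : EReal) := hr ▸ hy' (mem_univ y)
  have h2 : proxObjective κ f η x y ≤ proxObjective κ f η x z := hy (mem_univ z)
  have h3 := h2.trans (proxObjective_mid_le H hf hη hz hr.le h1)
  rw [hr, EReal.coe_le_coe_iff] at h3
  have h4 : 1 - cos (√κ * dist y y' / 2) ≤ 0 := by
    by_contra hn
    have := mul_pos (one_div_pos.2 hη) (not_le.1 hn)
    linarith
  have h5 := H.sq_dist_le y y'
  have h6 : dist y y' ^ 2 ≤ 0 :=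
    h5.trans (mul_nonpos_of_nonneg_of_nonpos (by positivity) h4)
  exact dist_eq_zero.1 (pow_eq_zero_iff two_ne_zero |>.1 (le_antisymm h6 (sq_nonneg _)))

theorem argmin_proxObjective_eq [CompleteSpace X] (H : HalfSpherical (√κ) X)
    (hf : IsProperLscConvex f) {η : ℝ} (hη : 0 < η) (x : X) :
    argmin (proxObjective κ f η x) = {proxResolvent κ f η x} := by
  have h := argmin_proxObjective_nonempty H hf hη x
  refine (argmin_proxObjective_subsingleton H hf hη x).eq_singleton_of_mem ?_
  rw [proxResolvent, dif_pos h]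
  exact h.some_mem

end CATProx

/-! ### The variational inequality and its consequences -/

namespace CATProx

variable {X : Type*} [MetricSpace X] {κ : ℝ} {f : X → EReal}

theorem inv_sub_self_anti {c c' : ℝ} (hc : 0 < c) (h : c ≤ c') : 1 / c' - c' ≤ 1 / c - c :=
  sub_le_sub (one_div_le_one_div_of_le hc h) h

/-- The variational inequality characterizing the resolvent. -/
theorem resolvent_inequality (H : HalfSpherical (√κ) X) (hf : IsProperLscConvex f) {η : ℝ}
    (hη : 0 < η) {x y z : X} (hy : y ∈ argmin (proxObjective κ f η x)) {u v : ℝ}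
    (hu : f y = u) (hv : f z = v) :
    η * (u - v) * sin (√κ * dist y z) ≤ (1 + 1 / cos (√κ * dist y x) ^ 2) *
      (√κ * dist y z *
        (cos (√κ * dist y z) * cos (√κ * dist y x) - cos (√κ * dist x z))) := by
  rcases eq_or_ne z y with rfl | hzy
  · simp
  have hD := mul_pos H.pos (dist_pos.2 hzy)
  have hs := H.sin_pos hzy
  have hπ : √κ * dist z y < π := by linarith [H.lt z y, pi_pos]
  rw [dist_comm y z, dist_comm x z]
  set D := √κ * dist z y
  set c₀ := cos (√κ * dist y x)
  have hc₀ : 0 < c₀ := H.cos_pos y x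
  set cz := cos (√κ * dist z x)
  have hcz : 0 < cz := H.cos_pos z x
  -- The spherical lower bound for the cosine of the distance to `x` along the geodesic from `y` (at
  -- `t = 0`) to `z`. Equality holds at 0, so the penalty may be replaced by the explicit
  -- differentiable function of `C t`.
  let C : ℝ → ℝ := fun t => (sin (t * D) * cz + sin ((1 - t) * D) * c₀) / sin D
  have hC0 : C 0 = c₀ := by simp [C, hs.ne']
  have hCd : HasDerivAt C ((cos (0 * D) * D * cz + cos ((1 - 0) * D) * (-D) * c₀) / sin D) 0 := by
    have h1 : HasDerivAt (fun t : ℝ => t * D) D 0 := by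
      simpa using (hasDerivAt_id (0 : ℝ)).mul_const D
    have h2 : HasDerivAt (fun t : ℝ => (1 - t) * D) (-D) 0 := by
      simpa using ((hasDerivAt_id (0 : ℝ)).const_sub 1).mul_const D
    exact ((h1.sin.mul_const cz).add (h2.sin.mul_const c₀)).div_const _
  set C' := (cos (0 * D) * D * cz + cos ((1 - 0) * D) * (-D) * c₀) / sin D with hC'
  have hψ : HasDerivAt (fun t => (C t)⁻¹ - C t) (-C' / c₀ ^ 2 - C') 0 := by
    have := (hCd.inv (by rw [hC0]; exact hc₀.ne')).sub hCd
    rwa [hC0] at this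
  have hlim := hψ.tendsto_slope_zero_right
  -- Minimality of `y` against the point with parameter `t`, divided by `t`, bounds every right
  -- difference quotient below.
  have hle : η * (u - v) ≤ -C' / c₀ ^ 2 - C' := by
    refine ge_of_tendsto hlim ?_
    filter_upwards [Ioo_mem_nhdsGT (zero_lt_one' ℝ)] with t ht
    obtain ⟨w, hw⟩ := H.exists_comb z y t
    have hfw := hf.le_of_isConvexComb ht hw hv.le hu.le
    have hCw : C t ≤ cos (√κ * dist w x) := by
      rw [div_le_iff₀ hs, mul_comm _ (sin D)]
      exact H.cos_le (Ioo_subset_Icc_self ht) hw x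
    have hCt : 0 < C t := by
      have h1 : 0 < sin (t * D) :=
        sin_pos_of_pos_of_lt_pi (mul_pos ht.1 hD) (by nlinarith [ht.2])
      have h2 : 0 < sin ((1 - t) * D) :=
        sin_pos_of_pos_of_lt_pi (mul_pos (sub_pos.2 ht.2) hD) (by nlinarith [ht.1])
      positivity
    have hmin : proxObjective κ f η x y ≤ proxObjective κ f η x w := hy (mem_univ w)
    rw [proxObjective_eq H, proxObjective_eq H, hu] at hmin
    have h2 := hmin.trans (add_le_add_left hfw _)
    rw [← EReal.coe_add, ← EReal.coe_add, EReal.coe_le_coe_iff] at h2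
    have h3 := mul_le_mul_of_nonneg_left (inv_sub_self_anti hCt hCw) (one_div_pos.2 hη).le
    have h4 : t * (u - v) ≤ 1 / η * ((1 / C t - C t) - (1 / c₀ - c₀)) := by linarith
    rw [one_div_mul_eq_div, le_div_iff₀ hη] at h4
    rw [zero_add, hC0, smul_eq_mul, inv_mul_eq_div, le_div_iff₀ ht.1, ← one_div, ← one_div]
    linarith
  have h5 := mul_le_mul_of_nonneg_right hle hs.le
  have h6 : C' * sin D = D * cz - cos D * D * c₀ := by
    rw [hC', div_mul_cancel₀ _ hs.ne']; simp; ring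
  calc _ ≤ _ := h5
    _ = -(C' * sin D) * (1 + 1 / c₀ ^ 2) := by ring
    _ = _ := by rw [h6]; ring

theorem exists_coe_of_mem_argmin_proxObjective (H : HalfSpherical (√κ) X)
    (hf : IsProperLscConvex f) {η : ℝ} {x y : X}
    (hy : y ∈ argmin (proxObjective κ f η x)) : ∃ u : ℝ, f y = u :=
  ⟨_, (EReal.coe_toReal (ne_top_of_mem_argmin_proxObjective H hf hy) (hf.ne_bot y)).symm⟩

/-- Here the left side of the variational inequality is nonnegative. Geometrically, a nondegenerate
comparison triangle has no acute angle at `y`. -/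
theorem cos_le_mul_of_le (H : HalfSpherical (√κ) X) (hf : IsProperLscConvex f) {η : ℝ}
    (hη : 0 < η) {x y z : X} (hy : y ∈ argmin (proxObjective κ f η x)) (hz : f z ≤ f y) :
    cos (√κ * dist x z) ≤ cos (√κ * dist y z) * cos (√κ * dist y x) := by
  rcases eq_or_ne y z with rfl | hzy
  · simp [dist_comm]
  obtain ⟨u, hu⟩ := exists_coe_of_mem_argmin_proxObjective H hf hy
  obtain ⟨v, hv⟩ : ∃ v : ℝ, f z = v := ⟨_, (EReal.coe_toReal
    (hz.trans_lt (hu ▸ EReal.coe_lt_top u)).ne (hf.ne_bot z)).symm⟩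
  have h := resolvent_inequality H hf hη hy hu hv
  rw [hu, hv, EReal.coe_le_coe_iff] at hz
  have hs := H.sin_pos hzy
  have h1 : 0 ≤ η * (u - v) * sin (√κ * dist y z) :=
    mul_nonneg (mul_nonneg hη.le (sub_nonneg.2 hz)) hs.le
  have hD := mul_pos H.pos (dist_pos.2 hzy)
  have hc := H.cos_pos y x
  have h2 := nonneg_of_mul_nonneg_right (h1.trans h) (by positivity)
  linarith [nonneg_of_mul_nonneg_right h2 hD]

/-- A drop of `ε` from `f y` to `f z` yields a definite gain: Jordan's inequality lets the factor
`√κ * dist y z` cancel. -/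
theorem mul_le_of_add_le (H : HalfSpherical (√κ) X) (hf : IsProperLscConvex f) {η : ℝ}
    (hη : 0 < η) {x y z : X} (hy : y ∈ argmin (proxObjective κ f η x)) {v ε : ℝ} (hε : 0 < ε)
    (hv : f z = v) (hz : ((v + ε : ℝ) : EReal) ≤ f y) :
    η * ε * (2 / π) ≤ (1 + 1 / cos (√κ * dist y x) ^ 2) *
      (cos (√κ * dist y z) * cos (√κ * dist y x) - cos (√κ * dist x z)) := by
  obtain ⟨u, hu⟩ := exists_coe_of_mem_argmin_proxObjective H hf hy
  have h := resolvent_inequality H hf hη hy hu hv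
  rw [hu, EReal.coe_le_coe_iff] at hz
  have hzy : y ≠ z := by
    rintro rfl
    rw [hu, EReal.coe_eq_coe_iff] at hv
    linarith
  have hD := mul_pos H.pos (dist_pos.2 hzy)
  have h1 := mul_le_sin hD.le (H.lt y z).le
  refine le_of_mul_le_mul_left ?_ hD
  calc _ = η * ε * (2 / π * (√κ * dist y z)) := by ring
    _ ≤ η * ε * sin (√κ * dist y z) := mul_le_mul_of_nonneg_left h1 (by positivity)
    _ ≤ η * (u - v) * sin (√κ * dist y z) :=
      mul_le_mul_of_nonneg_right (mul_le_mul_of_nonneg_left (by linarith) hη.le)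
        (H.sin_pos hzy).le
    _ ≤ _ := h
    _ = _ := by ring

/-- The Pythagorean inequality with an error, for comparison points `z` that are only almost
minimal; here `sin t ≤ t` cancels the factor. -/
theorem neg_mul_le_of_le_add (H : HalfSpherical (√κ) X) (hf : IsProperLscConvex f) {η : ℝ}
    (hη : 0 < η) {x y z : X} (hy : y ∈ argmin (proxObjective κ f η x)) {v ε : ℝ} (hε : 0 ≤ ε)
    (hv : (v : EReal) ≤ f y) (hz : f z ≤ ((v + ε : ℝ) : EReal)) :
    -(η * ε) ≤ (1 + 1 / cos (√κ * dist y x) ^ 2) *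
      (cos (√κ * dist y z) * cos (√κ * dist y x) - cos (√κ * dist x z)) := by
  rcases eq_or_ne y z with rfl | hzy
  · have : 0 ≤ η * ε := by positivity
    simpa [dist_comm] using this
  obtain ⟨u, hu⟩ := exists_coe_of_mem_argmin_proxObjective H hf hy
  obtain ⟨w, hw⟩ : ∃ w : ℝ, f z = w := ⟨_, (EReal.coe_toReal
    (hz.trans_lt (EReal.coe_lt_top _)).ne (hf.ne_bot z)).symm⟩
  have h := resolvent_inequality H hf hη hy hu hw
  rw [hw, EReal.coe_le_coe_iff] at hz
  rw [hu, EReal.coe_le_coe_iff] at hv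
  have hD := mul_pos H.pos (dist_pos.2 hzy)
  have h1 := sin_le hD.le
  refine le_of_mul_le_mul_left ?_ hD
  calc _ = -(η * ε * (√κ * dist y z)) := by ring
    _ ≤ -(η * ε * sin (√κ * dist y z)) :=
      neg_le_neg (mul_le_mul_of_nonneg_left h1 (by positivity))
    _ = η * (-ε) * sin (√κ * dist y z) := by ring
    _ ≤ η * (u - w) * sin (√κ * dist y z) :=
      mul_le_mul_of_nonneg_right (mul_le_mul_of_nonneg_left (by linarith) hη.le)
        (H.sin_pos hzy).le
    _ ≤ _ := h
    _ = _ := by ring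

/-- Fixed points of resolvents are minimizers. -/
theorem mem_argmin_of_fixed (H : HalfSpherical (√κ) X) (hf : IsProperLscConvex f) {η : ℝ}
    (hη : 0 < η) {p : X} (hp : p ∈ argmin (proxObjective κ f η p)) : p ∈ argmin f := by
  obtain ⟨u, hu⟩ := exists_coe_of_mem_argmin_proxObjective H hf hp
  intro z _
  show f p ≤ f z
  by_contra hn
  rw [not_le] at hn
  obtain ⟨v, hv⟩ : ∃ v : ℝ, f z = v := ⟨_, (EReal.coe_toReal
    (hn.trans_le le_top).ne (hf.ne_bot z)).symm⟩
  have h := resolvent_inequality H hf hη hp hu hv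
  have hzp : p ≠ z := by rintro rfl; exact hn.ne rfl
  rw [hu, hv, EReal.coe_lt_coe_iff] at hn
  have := mul_pos (mul_pos hη (sub_pos.2 hn)) (H.sin_pos hzp)
  simp at h
  linarith

/-- The Mann type proximal point iteration: `y n` is the resolvent of `x n`. -/
structure IsMannProx (κ : ℝ) (f : X → EReal) (a lam : ℕ → ℝ) (x y : ℕ → X) : Prop where
  mem_Ico (n : ℕ) : a n ∈ Ico (0 : ℝ) 1
  pos (n : ℕ) : 0 < lam n
  mem_argmin (n : ℕ) : y n ∈ argmin (proxObjective κ f (lam n) (x n))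
  comb (n : ℕ) : IsConvexComb (a n) (x n) (y n) (x (n + 1))

/-! ### Fejér monotonicity and values along the iteration -/

namespace IsMannProx

variable {a lam : ℕ → ℝ} {x y : ℕ → X}

theorem cos_le (h : IsMannProx κ f a lam x y) (H : HalfSpherical (√κ) X) (n : ℕ) (z : X) :
    (1 - a n) * (cos (√κ * dist (y n) z) - cos (√κ * dist (x n) z)) ≤
      cos (√κ * dist (x (n + 1)) z) - cos (√κ * dist (x n) z) := by
  have := H.comb_le (Ico_subset_Icc_self (h.mem_Ico n)) (h.comb n) z
  linarith

/-- The point `z` need not be a minimizer, only no higher than the current resolvent;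
`eventually_exists_near` depends on this. -/
theorem dist_le_of_le (h : IsMannProx κ f a lam x y) (H : HalfSpherical (√κ) X)
    (hf : IsProperLscConvex f) {n : ℕ} {z : X} (hz : f z ≤ f (y n)) :
    dist (y n) z ≤ dist (x n) z := by
  rw [← H.cos_le_cos_iff]
  refine (cos_le_mul_of_le H hf (h.pos n) (h.mem_argmin n) hz).trans ?_
  exact mul_le_of_le_one_right (H.cos_pos _ _).le (cos_le_one _)

theorem dist_succ_le_of_le (h : IsMannProx κ f a lam x y) (H : HalfSpherical (√κ) X)
    (hf : IsProperLscConvex f) {n : ℕ} {z : X} (hz : f z ≤ f (y n)) :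
    dist (x (n + 1)) z ≤ dist (x n) z :=
  H.dist_comb_le (Ico_subset_Icc_self (h.mem_Ico n)) (h.comb n) le_rfl (h.dist_le_of_le H hf hz)

theorem antitone_dist (h : IsMannProx κ f a lam x y) (H : HalfSpherical (√κ) X)
    (hf : IsProperLscConvex f) {u : X} (hu : u ∈ argmin f) : Antitone fun n => dist (x n) u :=
  antitone_nat_of_succ_le fun n => h.dist_succ_le_of_le H hf (hu (mem_univ (y n)))

theorem dist_resolvent_le (h : IsMannProx κ f a lam x y) (H : HalfSpherical (√κ) X)
    (hf : IsProperLscConvex f) {u : X} (hu : u ∈ argmin f) (n : ℕ) :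
    dist (y n) (x n) ≤ dist (x 0) u := by
  refine le_trans ?_ (h.antitone_dist H hf hu (Nat.zero_le n))
  rw [← H.cos_le_cos_iff]
  refine (cos_le_mul_of_le H hf (h.pos n) (h.mem_argmin n) (hu (mem_univ (y n)))).trans ?_
  exact mul_le_of_le_one_left (H.cos_pos _ _).le (cos_le_one _)

/-- The values of `f` along the resolvents come arbitrarily close to the infimum of `f`. -/
theorem frequently_lt (h : IsMannProx κ f a lam x y) (H : HalfSpherical (√κ) X)
    (hf : IsProperLscConvex f)
    (hsum : Tendsto (fun N => ∑ n ∈ Finset.range N, (1 - a n) * lam n) atTop atTop)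
    {s : ℝ} (hs : √κ * s < π / 2) (hys : ∀ n, dist (y n) (x n) ≤ s) {z : X} {v ε : ℝ}
    (hε : 0 < ε) (hv : f z = v) : ∃ᶠ n in atTop, f (y n) < ((v + ε : ℝ) : EReal) := by
  intro hcon
  simp only [not_lt, eventually_atTop] at hcon
  obtain ⟨N, hN⟩ := hcon
  have hs0 : 0 ≤ √κ * s := mul_nonneg H.pos.le (dist_nonneg.trans (hys 0))
  have hcs : 0 < cos (√κ * s) := cos_pos_of_mem_Ioo ⟨by linarith [pi_pos], hs⟩
  -- The gain of `mul_le_of_add_le` per unit of `lam n`, with the prefactor at its worst when `dist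
  -- (y n) (x n) ≤ s`.
  set ρ := ε * (2 / π) / (1 + 1 / cos (√κ * s) ^ 2) with hρ
  have hρ0 : 0 < ρ := by positivity
  have hstep : ∀ n, N ≤ n → ρ * ((1 - a n) * lam n) ≤
      cos (√κ * dist (x (n + 1)) z) - cos (√κ * dist (x n) z) := by
    intro n hn
    have h1 := mul_le_of_add_le H hf (h.pos n) (h.mem_argmin n) hε hv (hN n hn)
    have hc := H.cos_pos (y n) (x n)
    have hT := pos_of_mul_pos_right (lt_of_lt_of_le
      (mul_pos (mul_pos (h.pos n) hε) (by positivity)) h1) (by positivity)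
    have h2 : cos (√κ * s) ≤ cos (√κ * dist (y n) (x n)) :=
      cos_le_cos_of_nonneg_of_le_pi (H.nonneg _ _) (by linarith [pi_pos])
        (mul_le_mul_of_nonneg_left (hys n) H.pos.le)
    have h3 : 1 + 1 / cos (√κ * dist (y n) (x n)) ^ 2 ≤ 1 + 1 / cos (√κ * s) ^ 2 := by
      gcongr
    have h4 := h1.trans (mul_le_mul_of_nonneg_right h3 hT.le)
    have h5 : lam n * ρ ≤ cos (√κ * dist (y n) z) - cos (√κ * dist (x n) z) := by
      have h6 : lam n * ρ = lam n * ε * (2 / π) / (1 + 1 / cos (√κ * s) ^ 2) := by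
        rw [hρ]; ring
      rw [h6, div_le_iff₀ (by positivity)]
      refine h4.trans ?_
      rw [mul_comm]
      refine mul_le_mul_of_nonneg_right ?_ (by positivity)
      have := mul_le_of_le_one_right (H.cos_pos (y n) z).le (cos_le_one (√κ * dist (y n) (x n)))
      linarith
    refine le_trans ?_ (h.cos_le H n z)
    have := mul_le_mul_of_nonneg_left h5 (sub_nonneg.2 (h.mem_Ico n).2.le)
    linarith
  set S : ℕ → ℝ := fun N => ∑ n ∈ Finset.range N, (1 - a n) * lam n
  have hind : ∀ n, N ≤ n → ρ * (S n - S N) ≤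
      cos (√κ * dist (x n) z) - cos (√κ * dist (x N) z) := by
    intro n hn
    induction n, hn using Nat.le_induction with
    | base => simp
    | succ n hn ih =>
      have h1 := hstep n hn
      have h2 : S (n + 1) = S n + (1 - a n) * lam n := Finset.sum_range_succ _ _
      rw [h2]
      linarith
  -- The telescoped gain eventually exceeds 1, impossible for cosines in `(0, 1]`.
  obtain ⟨n, hn, hSn⟩ := ((eventually_ge_atTop N).and
    (hsum.eventually_gt_atTop (S N + 1 / ρ))).exists
  have h1 := hind n hn
  have h2 : 1 < ρ * (S n - S N) := by
    have h3 : 1 / ρ < S n - S N := by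
      have : S N + 1 / ρ < S n := hSn
      linarith
    rwa [div_lt_iff₀' hρ0] at h3
  linarith [cos_le_one (√κ * dist (x n) z), H.cos_pos (x N) z]

end IsMannProx

end CATProx

/-! ### Asymptotic radii and centers -/

namespace HalfSpherical

variable {X : Type*} [MetricSpace X] {k : ℝ} {w w' : ℕ → X} {z z' : X} {r s : ℝ}

theorem isBoundedUnder_dist (H : HalfSpherical k X) (w : ℕ → X) (z : X) :
    IsBoundedUnder (· ≤ ·) atTop fun n => dist z (w n) :=
  isBoundedUnder_of ⟨π / 2 / k, fun n => by
    rw [le_div_iff₀ H.pos, mul_comm]; exact (H.lt _ _).le⟩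

theorem cos_le_cos_add (H : HalfSpherical k X) (z p q : X) :
    cos (k * dist z p) ≤ cos (k * dist z q) + k * dist p q := by
  have h1 := abs_cos_sub_cos_le (k * dist z p) (k * dist z q)
  rw [← mul_sub, abs_mul, abs_of_pos H.pos, dist_comm z p, dist_comm z q] at h1
  have h2 := mul_le_mul_of_nonneg_left (abs_dist_sub_le p q z) H.pos.le
  rw [dist_comm z p, dist_comm z q]
  linarith [le_abs_self (cos (k * dist p z) - cos (k * dist q z))]

end HalfSpherical

namespace CATProx

variable {X : Type*} [MetricSpace X] {κ k : ℝ} {w w' : ℕ → X} {z z' : X} {r s : ℝ}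

theorem isCoboundedUnder_dist (w : ℕ → X) (z : X) :
    IsCoboundedUnder (· ≤ ·) atTop fun n => dist z (w n) :=
  (isBoundedUnder_of ⟨0, fun _ => dist_nonneg⟩ :
    IsBoundedUnder (· ≥ ·) atTop fun n => dist z (w n)).isCoboundedUnder_le

theorem limsupDist_le_of_eventually (h : ∀ᶠ n in atTop, dist z (w n) ≤ r) : limsupDist w z ≤ r :=
  limsup_le_of_le (isCoboundedUnder_dist w z) h

theorem eventually_dist_lt (H : HalfSpherical k X) (h : limsupDist w z < r) :
    ∀ᶠ n in atTop, dist z (w n) < r :=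
  eventually_lt_of_limsup_lt h (H.isBoundedUnder_dist w z)

theorem frequently_lt_dist (h : r < limsupDist w z) : ∃ᶠ n in atTop, r < dist z (w n) :=
  frequently_lt_of_lt_limsup (isCoboundedUnder_dist w z) h

theorem limsupDist_nonneg (H : HalfSpherical k X) (w : ℕ → X) (z : X) : 0 ≤ limsupDist w z :=
  le_limsup_of_frequently_le (Frequently.of_forall fun _ => dist_nonneg)
    (H.isBoundedUnder_dist w z)

theorem mul_limsupDist_le (H : HalfSpherical k X) (w : ℕ → X) (z : X) :
    k * limsupDist w z ≤ π / 2 := by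
  have : limsupDist w z ≤ π / 2 / k := limsupDist_le_of_eventually (Eventually.of_forall fun n => by
    rw [le_div_iff₀ H.pos, mul_comm]; exact (H.lt _ _).le)
  rwa [le_div_iff₀ H.pos, mul_comm] at this

theorem limsupDist_le_add (H : HalfSpherical k X)
    (h : ∀ ε > 0, ∀ᶠ n in atTop, dist z (w n) ≤ dist z' (w' n) + s + ε) :
    limsupDist w z ≤ limsupDist w' z' + s := by
  refine le_of_forall_pos_le_add fun ε hε => limsupDist_le_of_eventually ?_
  filter_upwards [h (ε / 2) (half_pos hε),
    eventually_dist_lt H (lt_add_of_pos_right (limsupDist w' z') (half_pos hε))] with n h1 h2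
  linarith

theorem limsupDist_congr (H : HalfSpherical k X)
    (h : Tendsto (fun n => dist (w n) (w' n)) atTop (𝓝 0)) (z : X) :
    limsupDist w z = limsupDist w' z := by
  refine le_antisymm ?_ ?_
  · simpa using limsupDist_le_add (s := 0) H fun ε hε => by
      filter_upwards [h.eventually_lt_const hε] with n hn
      linarith [dist_triangle_right z (w n) (w' n)]
  · simpa using limsupDist_le_add (s := 0) H fun ε hε => by
      filter_upwards [h.eventually_lt_const hε] with n hn
      linarith [dist_triangle z (w n) (w' n)]

theorem continuous_limsupDist (H : HalfSpherical k X) (w : ℕ → X) :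
    Continuous (limsupDist w) := by
  refine (LipschitzWith.of_le_add fun z z' => ?_).continuous
  refine limsupDist_le_add H fun ε hε => Eventually.of_forall fun n => ?_
  linarith [dist_triangle z z' (w n)]

theorem asympRadius_le (H : HalfSpherical k X) (w : ℕ → X) (z : X) :
    asympRadius w ≤ limsupDist w z :=
  ciInf_le ⟨0, by rintro _ ⟨z, rfl⟩; exact limsupDist_nonneg H w z⟩ z

theorem asympRadius_nonneg [Nonempty X] (H : HalfSpherical k X) (w : ℕ → X) : 0 ≤ asympRadius w :=
  le_ciInf fun z => limsupDist_nonneg H w z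

/-- The cosine of the asymptotic distance to a sequence is uniformly concave. -/
theorem cos_limsupDist_mid_le (H : HalfSpherical k X) (w : ℕ → X) {x y z : X}
    (hz : IsConvexComb (1 / 2) x y z) :
    cos (k * limsupDist w x) + cos (k * limsupDist w y) ≤
      2 * cos (k * dist x y / 2) * cos (k * limsupDist w z) := by
  have hk := H.pos
  set e := cos (k * dist x y / 2)
  have he : 0 ≤ e := cos_nonneg_of_mem_Icc ⟨by linarith [H.nonneg x y, pi_pos],
    by linarith [H.lt x y, H.nonneg x y]⟩
  have hlx := mul_limsupDist_le H w x
  have hly := mul_limsupDist_le H w y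
  have hx0 := mul_nonneg hk.le (limsupDist_nonneg H w x)
  have hy0 := mul_nonneg hk.le (limsupDist_nonneg H w y)
  -- The midpoint inequality is applied at an index where all three distances are within `ε` of the
  -- needed side of their limsup, then `ε` tends to 0. The maximum with 0 keeps the argument where
  -- the cosine decreases.
  let F : ℝ → ℝ := fun ε => 2 * e * cos (k * max (limsupDist w z - ε) 0) -
    (cos (k * (limsupDist w x + ε)) + cos (k * (limsupDist w y + ε)))
  have hF : Continuous F := by fun_prop
  have hF0 : F 0 = 2 * e * cos (k * limsupDist w z) -
      (cos (k * limsupDist w x) + cos (k * limsupDist w y)) := by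
    simp [F, max_eq_left (limsupDist_nonneg H w z)]
  have hlim : Tendsto F (𝓝[>] 0) (𝓝 (F 0)) := hF.continuousAt.tendsto.mono_left nhdsWithin_le_nhds
  have hnn : 0 ≤ F 0 := by
    refine ge_of_tendsto hlim ?_
    filter_upwards [Ioo_mem_nhdsGT (show (0 : ℝ) < π / 2 / k by positivity)] with ε hε
    have hkε : k * ε ≤ π / 2 := by
      have := (lt_div_iff₀ hk).1 hε.2
      linarith
    obtain ⟨n, ⟨h1, h2⟩, h3⟩ :=
      ((frequently_lt_dist (sub_lt_self (limsupDist w z) hε.1)).and_eventually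
        (eventually_dist_lt H (lt_add_of_pos_right (limsupDist w x) hε.1)) |>.and_eventually
        (eventually_dist_lt H (lt_add_of_pos_right (limsupDist w y) hε.1))).exists
    have h4 := H.mid_le hz (w n)
    have h5 : cos (k * (limsupDist w x + ε)) ≤ cos (k * dist x (w n)) :=
      cos_le_cos_of_nonneg_of_le_pi (H.nonneg _ _) (by linarith)
        (mul_le_mul_of_nonneg_left h2.le hk.le)
    have h6 : cos (k * (limsupDist w y + ε)) ≤ cos (k * dist y (w n)) :=
      cos_le_cos_of_nonneg_of_le_pi (H.nonneg _ _) (by linarith)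
        (mul_le_mul_of_nonneg_left h3.le hk.le)
    have h7 : cos (k * dist z (w n)) ≤ cos (k * max (limsupDist w z - ε) 0) :=
      cos_le_cos_of_nonneg_of_le_pi (mul_nonneg hk.le (le_max_right _ _))
        (by linarith [H.lt z (w n), pi_pos])
        (mul_le_mul_of_nonneg_left (max_le h1.le dist_nonneg) hk.le)
    have h8 := mul_le_mul_of_nonneg_left h7 (mul_nonneg zero_le_two he)
    show 0 ≤ 2 * e * cos (k * max (limsupDist w z - ε) 0) -
      (cos (k * (limsupDist w x + ε)) + cos (k * (limsupDist w y + ε)))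
    linarith
  linarith

/-- Existence and uniqueness of the asymptotic center. -/
theorem exists_asympCenter_eq [CompleteSpace X] [Nonempty X] (H : HalfSpherical k X) (w : ℕ → X)
    (hw : k * asympRadius w < π / 2) : ∃ p, asympCenter w = {p} := by
  have hk := H.pos
  have hr0 := mul_nonneg hk.le (asympRadius_nonneg H w)
  have hne : (asympCenter w).Nonempty := by
    obtain ⟨r, hr, hr'⟩ := exists_between
      (show asympRadius w < π / 2 / k by rwa [lt_div_iff₀ hk, mul_comm])
    rw [lt_div_iff₀ hk, mul_comm] at hr'
    have hr1 := mul_lt_mul_of_pos_left hr hk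
    obtain ⟨p, hp⟩ := H.nonempty_iInter (fun z => cos (k * limsupDist w z))
      (fun x y z hz => cos_limsupDist_mid_le H w hz) (fun x => cos_le_one _)
      (fun n => {z | limsupDist w z ≤ asympRadius w + 1 / ((n : ℝ) + 1)})
      (fun n m hnm z (hz : limsupDist w z ≤ _) => hz.trans (by
        have := Nat.one_div_le_one_div (α := ℝ) hnm
        linarith))
      (fun n => isClosed_le (continuous_limsupDist H w) continuous_const)
      (fun n x y z (hx : limsupDist w x ≤ _) (hy : limsupDist w y ≤ _) hz => by
        show limsupDist w z ≤ _
        refine le_of_forall_pos_le_add fun ε hε => limsupDist_le_of_eventually ?_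
        filter_upwards [eventually_dist_lt H (hx.trans_lt (lt_add_of_pos_right _ hε)),
          eventually_dist_lt H (hy.trans_lt (lt_add_of_pos_right _ hε))] with n h1 h2
        exact H.dist_comb_le (by norm_num) hz h1.le h2.le)
      (c₀ := cos (k * r)) (cos_pos_of_mem_Ioo ⟨by linarith [pi_pos], hr'⟩)
      (fun n => by
        have hpos : 0 < 1 / ((n : ℝ) + 1) := by positivity
        obtain ⟨z, hz⟩ := exists_lt_of_ciInf_lt
          (show ⨅ z, limsupDist w z < min r (asympRadius w + 1 / ((n : ℝ) + 1)) from
            lt_min hr (lt_add_of_pos_right _ hpos))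
        refine ⟨z, (hz.trans_le (min_le_right _ _)).le, ?_⟩
        exact cos_le_cos_of_nonneg_of_le_pi (mul_nonneg hk.le (limsupDist_nonneg H w z))
          (by linarith [pi_pos])
          (mul_le_mul_of_nonneg_left (hz.trans_le (min_le_left _ _)).le hk.le))
    rw [mem_iInter] at hp
    refine ⟨p, le_antisymm ?_ (asympRadius_le H w p)⟩
    have hlim : Tendsto (fun n : ℕ => asympRadius w + 1 / ((n : ℝ) + 1)) atTop
        (𝓝 (asympRadius w + 0)) := tendsto_one_div_add_atTop_nhds_zero_nat.const_add _
    rw [add_zero] at hlim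
    exact ge_of_tendsto' hlim hp
  obtain ⟨p, hp⟩ := hne
  refine ⟨p, Subsingleton.eq_singleton_of_mem (fun x hx y hy => ?_) hp⟩
  -- The midpoint of two distinct centers would have smaller asymptotic distance than the radius.
  obtain ⟨z, hz⟩ := H.exists_comb x y (1 / 2)
  have h1 := cos_limsupDist_mid_le H w hz
  rw [show limsupDist w x = asympRadius w from hx, show limsupDist w y = asympRadius w from hy] at h1
  have h2 : cos (k * limsupDist w z) ≤ cos (k * asympRadius w) :=
    cos_le_cos_of_nonneg_of_le_pi hr0 (by linarith [mul_limsupDist_le H w z, pi_pos])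
      (mul_le_mul_of_nonneg_left (asympRadius_le H w z) hk.le)
  have hc : 0 < cos (k * asympRadius w) := cos_pos_of_mem_Ioo ⟨by linarith [pi_pos], hw⟩
  have he : 0 ≤ cos (k * dist x y / 2) := cos_nonneg_of_mem_Icc
    ⟨by linarith [H.nonneg x y, pi_pos], by linarith [H.lt x y, H.nonneg x y]⟩
  have h3 := mul_le_mul_of_nonneg_left h2 he
  have h4 : 1 - cos (k * dist x y / 2) ≤ 0 := by
    by_contra hn
    have := mul_pos (not_le.1 hn) hc
    linarith
  have h6 : dist x y ^ 2 ≤ 0 :=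
    (H.sq_dist_le x y).trans (mul_nonpos_of_nonneg_of_nonpos (by positivity) h4)
  exact dist_eq_zero.1 (pow_eq_zero_iff two_ne_zero |>.1 (le_antisymm h6 (sq_nonneg _)))

/-! ### Existence of minimizers and Δ-convergence -/

namespace IsMannProx

variable {f : X → EReal} {a lam : ℕ → ℝ} {x y : ℕ → X}

theorem exists_of_mem_argmin (h : IsMannProx κ f a lam x y) (H : HalfSpherical (√κ) X)
    (hf : IsProperLscConvex f) {u : X} (hu : u ∈ argmin f) : ∃ v : ℝ, f u = v := by
  have hy := ne_top_of_mem_argmin_proxObjective H hf (h.mem_argmin 0)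
  have hle : f u ≤ f (y 0) := hu (mem_univ _)
  exact ⟨_, (EReal.coe_toReal (hle.trans_lt (lt_top_iff_ne_top.2 hy)).ne (hf.ne_bot u)).symm⟩

/-- The resolvents eventually lie in one ball about `q` of radius below `D_κ / 2`, and infinitely
often below any level above the infimum. Hence every such sublevel set meets that ball. -/
theorem argmin_nonempty [CompleteSpace X] (h : IsMannProx κ f a lam x y)
    (H : HalfSpherical (√κ) X) (hf : IsProperLscConvex f)
    (hsum : Tendsto (fun N => ∑ n ∈ Finset.range N, (1 - a n) * lam n) atTop atTop)
    {s : ℝ} (hs : √κ * s < π / 2) (hys : ∀ n, dist (y n) (x n) ≤ s)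
    (hr : √κ * asympRadius y < π / 2) : (argmin f).Nonempty := by
  have hk := H.pos
  have : Nonempty X := ⟨x 0⟩
  obtain ⟨q, hq⟩ := exists_lt_of_ciInf_lt
    (show ⨅ z, limsupDist y z < π / 2 / √κ by rw [lt_div_iff₀ hk, mul_comm]; exact hr)
  obtain ⟨r, hqr, hr'⟩ := exists_between hq
  rw [lt_div_iff₀ hk, mul_comm] at hr'
  have hr0 : 0 ≤ √κ * r := mul_nonneg hk.le ((limsupDist_nonneg H y q).trans hqr.le)
  have hev := eventually_dist_lt H hqr
  refine H.argmin_nonempty f hf.lsc (fun x y z r => hf.sublevel_mid) q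
    (c₀ := cos (√κ * r)) (cos_pos_of_mem_Ioo ⟨by linarith [pi_pos], hr'⟩) fun b hb => ?_
  obtain ⟨z, hz⟩ := iInf_lt_iff.1 hb
  have hfreq : ∃ᶠ n in atTop, f (y n) ≤ b := by
    induction b with
    | bot => exact absurd hz not_lt_bot
    | top => exact Frequently.of_forall fun _ => le_top
    | coe b =>
      obtain ⟨v, hv⟩ : ∃ v : ℝ, f z = v := ⟨_, (EReal.coe_toReal
        (hz.trans_le le_top).ne (hf.ne_bot z)).symm⟩
      rw [hv, EReal.coe_lt_coe_iff] at hz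
      refine (h.frequently_lt H hf hsum hs hys (sub_pos.2 hz) hv).mono fun n hn => ?_
      simpa using hn.le
  obtain ⟨n, hn, hn'⟩ := (hfreq.and_eventually hev).exists
  refine ⟨y n, hn, cos_le_cos_of_nonneg_of_le_pi (H.nonneg _ _) (by linarith [pi_pos]) ?_⟩
  rw [dist_comm]
  exact mul_le_mul_of_nonneg_left hn'.le hk.le

/-- The cosines `T n` increase and are bounded, so their increments vanish; each increment is at
least `(1 - A) * T 0 * (1 - cos (√κ * dist (x n) (y n)))`. -/
theorem tendsto_dist (h : IsMannProx κ f a lam x y) (H : HalfSpherical (√κ) X)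
    (hf : IsProperLscConvex f) {A : ℝ} (hA : A < 1) (haA : ∀ n, a n ≤ A) {u : X}
    (hu : u ∈ argmin f) : Tendsto (fun n => dist (x n) (y n)) atTop (𝓝 0) := by
  have hk := H.pos
  set T : ℕ → ℝ := fun n => cos (√κ * dist (x n) u) with hT
  have hmono : Monotone T := fun n m hnm => H.cos_le_cos_iff.2 (h.antitone_dist H hf hu hnm)
  have hlim := tendsto_atTop_ciSup hmono ⟨1, by rintro _ ⟨n, rfl⟩; exact cos_le_one _⟩
  have hdiff : Tendsto (fun n => T (n + 1) - T n) atTop (𝓝 0) := by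
    simpa using (hlim.comp (tendsto_add_atTop_nat 1)).sub hlim
  have hT0 : 0 < T 0 := H.cos_pos _ _
  have hA0 : 0 < 1 - A := sub_pos.2 hA
  have hsq : Tendsto (fun n => dist (x n) (y n) ^ 2) atTop (𝓝 0) := by
    refine squeeze_zero (fun n => sq_nonneg _) (fun n => ?_)
      (g := fun n => 2 * π ^ 2 / √κ ^ 2 * ((T (n + 1) - T n) / ((1 - A) * T 0)))
      (by simpa using (hdiff.div_const ((1 - A) * T 0)).const_mul (2 * π ^ 2 / √κ ^ 2))
    refine (H.sq_dist_le _ _).trans (mul_le_mul_of_nonneg_left ?_ (by positivity))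
    have h1 : cos (√κ * dist (x n) (y n)) ≤ cos (√κ * dist (x n) (y n) / 2) := by
      have := H.nonneg (x n) (y n)
      exact cos_le_cos_of_nonneg_of_le_pi (by linarith)
        (by linarith [H.lt (x n) (y n), pi_pos]) (by linarith)
    rw [le_div_iff₀ (mul_pos hA0 hT0)]
    have h2 := cos_le_mul_of_le H hf (h.pos n) (h.mem_argmin n) (hu (mem_univ (y n)))
    have h3 := h.cos_le H n u
    rw [dist_comm (y n) (x n)] at h2
    have h4 : T 0 ≤ cos (√κ * dist (y n) u) := (hmono (Nat.zero_le n)).trans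
      (H.cos_le_cos_iff.2 (h.dist_le_of_le H hf (hu (mem_univ (y n)))))
    have h5 := sub_nonneg.2 (cos_le_one (√κ * dist (x n) (y n)))
    have h6 : T 0 * (1 - cos (√κ * dist (x n) (y n))) ≤
        cos (√κ * dist (y n) u) - cos (√κ * dist (x n) u) := by
      linarith [mul_le_mul_of_nonneg_right h4 h5]
    have h7 : 0 ≤ cos (√κ * dist (y n) u) - cos (√κ * dist (x n) u) :=
      le_trans (mul_nonneg hT0.le h5) h6
    calc _ ≤ (1 - cos (√κ * dist (x n) (y n))) * ((1 - A) * T 0) :=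
          mul_le_mul_of_nonneg_right (by linarith) (mul_pos hA0 hT0).le
      _ = (1 - A) * (T 0 * (1 - cos (√κ * dist (x n) (y n)))) := by ring
      _ ≤ (1 - A) * (cos (√κ * dist (y n) u) - cos (√κ * dist (x n) u)) :=
          mul_le_mul_of_nonneg_left h6 hA0.le
      _ ≤ (1 - a n) * (cos (√κ * dist (y n) u) - cos (√κ * dist (x n) u)) :=
          mul_le_mul_of_nonneg_right (by linarith [haA n]) h7
      _ ≤ _ := h3
  have := hsq.sqrt
  simpa [sqrt_sq dist_nonneg] using this

/-- The iterates approach every sublevel set of `f`. -/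
theorem eventually_exists_near (h : IsMannProx κ f a lam x y) (H : HalfSpherical (√κ) X)
    (hf : IsProperLscConvex f)
    (hlim : Tendsto (fun n => dist (x n) (y n)) atTop (𝓝 0)) {b : EReal}
    (hb : ∃ᶠ n in atTop, f (y n) < b) {ε : ℝ} (hε : 0 < ε) :
    ∀ᶠ n in atTop, ∃ z, f z < b ∧ dist (x n) z < ε := by
  obtain ⟨N, hN⟩ := eventually_atTop.1 (hlim.eventually_lt_const hε)
  have hstep : ∀ n, N ≤ n → dist (x (n + 1)) (y n) < ε := fun n hn => by
    rw [(h.comb n).dist_right (Ico_subset_Icc_self (h.mem_Ico n))]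
    exact (mul_le_of_le_one_left dist_nonneg (h.mem_Ico n).2.le).trans_lt (hN n hn)
  obtain ⟨M, hM, hMN⟩ := (hb.and_eventually (eventually_ge_atTop N)).exists
  filter_upwards [eventually_ge_atTop (M + 1)] with n hn
  induction n, hn using Nat.le_induction with
  | base => exact ⟨y M, hM, hstep M hMN⟩
  | succ n hn ih =>
    -- No monotonicity of `f (y n)` is needed: a resolvent below the level is a new witness, and
    -- otherwise the old witness is no higher than `y n`, so the step does not move away from it.
    rcases lt_or_ge (f (y n)) b with hlt | hge
    · exact ⟨y n, hlt, hstep n (by omega)⟩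
    · obtain ⟨z, hz, hd⟩ := ih
      exact ⟨z, hz, (h.dist_succ_le_of_le H hf (hz.le.trans hge)).trans_lt hd⟩

end IsMannProx

/-- Asymptotic centers of minimizing sequences in a weak sense are minimizers. -/
theorem mem_argmin_of_asympCenter [CompleteSpace X] {f : X → EReal} (H : HalfSpherical (√κ) X)
    (hf : IsProperLscConvex f) {v : ℝ} (hv : ∀ z, (v : EReal) ≤ f z) {w : ℕ → X}
    (hw : ∀ ε > 0, ∀ᶠ n in atTop, ∃ z, f z < ((v + ε : ℝ) : EReal) ∧ dist (w n) z < ε) {p : X}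
    (hp : asympCenter w = {p}) : p ∈ argmin f := by
  have hk := H.pos
  obtain ⟨q, hq⟩ := argmin_proxObjective_nonempty H hf one_pos p
  have hcq := H.cos_pos q p
  -- One `ε` comes from the approximate Pythagorean inequality; each of the two replacements between
  -- `z` and `w n` costs `√κ * ε`.
  have hcos : ∀ ε > 0, ∀ᶠ n in atTop,
      cos (√κ * dist p (w n)) - (1 + 2 * √κ) * ε ≤ cos (√κ * dist q (w n)) := by
    intro ε hε
    filter_upwards [hw ε hε] with n hn
    obtain ⟨z, hz, hd⟩ := hn
    have h1 := neg_mul_le_of_le_add H hf one_pos hq hε.le (hv q) hz.le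
    set M := 1 + 1 / cos (√κ * dist q p) ^ 2
    have hM : 1 ≤ M := le_add_of_nonneg_right (by positivity)
    have h2 : -ε ≤ cos (√κ * dist q z) * cos (√κ * dist q p) - cos (√κ * dist p z) := by
      by_contra hn
      have := mul_le_mul_of_nonneg_right hM (show 0 ≤ ε by positivity)
      nlinarith
    have h3 := mul_le_of_le_one_right (H.cos_pos q z).le (cos_le_one (√κ * dist q p))
    have h4 := H.cos_le_cos_add p (w n) z
    have h5 := H.cos_le_cos_add q z (w n)
    rw [dist_comm z] at h5
    have h6 := mul_le_mul_of_nonneg_left hd.le hk.le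
    linarith
  have hle : limsupDist w q ≤ limsupDist w p := by
    have hl := mul_limsupDist_le H w p
    have hl0 := limsupDist_nonneg H w p
    set l := limsupDist w p
    by_contra hlt
    rw [not_le] at hlt
    obtain ⟨r, hlr, hrq⟩ := exists_between hlt
    obtain ⟨r', hlr', hrr'⟩ := exists_between hlr
    have hq' := mul_limsupDist_le H w q
    have hkr := mul_lt_mul_of_pos_left hrq hk
    have hkr' := mul_lt_mul_of_pos_left hrr' hk
    have hkl := mul_lt_mul_of_pos_left hlr' hk
    have hkl0 := mul_nonneg hk.le hl0
    have hgap : cos (√κ * r) < cos (√κ * r') :=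
      cos_lt_cos_of_nonneg_of_le_pi (by linarith) (by linarith [pi_pos]) hkr'
    have hε : 0 < (cos (√κ * r') - cos (√κ * r)) / (1 + 2 * √κ) :=
      div_pos (sub_pos.2 hgap) (by positivity)
    refine absurd (limsupDist_le_of_eventually ?_) (not_le.2 hrq)
    filter_upwards [hcos _ hε, eventually_dist_lt H hlr'] with n h1 h2
    rw [mul_div_cancel₀ _ (by positivity)] at h1
    have h3 : cos (√κ * r') ≤ cos (√κ * dist p (w n)) :=
      cos_le_cos_of_nonneg_of_le_pi (H.nonneg _ _) (by linarith [pi_pos])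
        (mul_le_mul_of_nonneg_left h2.le hk.le)
    by_contra hn
    rw [not_le] at hn
    have h4 : cos (√κ * dist q (w n)) < cos (√κ * r) :=
      cos_lt_cos_of_nonneg_of_le_pi (by linarith) (by linarith [H.lt q (w n), pi_pos])
        (mul_lt_mul_of_pos_left hn hk)
    linarith
  have hpc : limsupDist w p = asympRadius w := by
    have : p ∈ asympCenter w := hp ▸ mem_singleton p
    exact this
  -- The resolvent `q` of `p` is asymptotically no farther from `w` than `p`, so uniqueness of the
  -- center makes `p` a fixed point.
  have hqc : q ∈ asympCenter w := le_antisymm (hle.trans hpc.le) (asympRadius_le H w q)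
  rw [hp, mem_singleton_iff] at hqc
  subst hqc
  exact mem_argmin_of_fixed H hf one_pos hq

/-- Opial's argument: for a minimizer the distances to `x n` converge, so the limsup is the same
along every subsequence. The center of the whole sequence is therefore at least as close to a
subsequence as that subsequence's own center. -/
theorem IsMannProx.exists_deltaConverges [CompleteSpace X] {f : X → EReal} {a lam : ℕ → ℝ}
    {x y : ℕ → X} (h : IsMannProx κ f a lam x y) (H : HalfSpherical (√κ) X)
    (hf : IsProperLscConvex f)
    (hsum : Tendsto (fun N => ∑ n ∈ Finset.range N, (1 - a n) * lam n) atTop atTop)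
    {A : ℝ} (hA : A < 1) (haA : ∀ n, a n ≤ A) (hne : (argmin f).Nonempty) :
    ∃ p ∈ argmin f, DeltaConverges x p ∧ DeltaConverges y p := by
  obtain ⟨u, hu⟩ := hne
  have hk := H.pos
  have : Nonempty X := ⟨u⟩
  obtain ⟨v, hv⟩ := h.exists_of_mem_argmin H hf hu
  have hlim := h.tendsto_dist H hf hA haA hu
  have hnear : ∀ ε > 0, ∀ᶠ n in atTop, ∃ z, f z < ((v + ε : ℝ) : EReal) ∧ dist (x n) z < ε :=
    fun ε hε => h.eventually_exists_near H hf hlim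
      (h.frequently_lt H hf hsum (H.lt (x 0) u) (h.dist_resolvent_le H hf hu) hε hv) hε
  have hmin : ∀ φ : ℕ → ℕ, StrictMono φ → ∃ p ∈ argmin f, asympCenter (x ∘ φ) = {p} := by
    intro φ hφ
    have hr : asympRadius (x ∘ φ) ≤ dist (x 0) u :=
      (asympRadius_le H _ u).trans (limsupDist_le_of_eventually (Eventually.of_forall fun n => by
        rw [dist_comm]; exact h.antitone_dist H hf hu (Nat.zero_le (φ n))))
    obtain ⟨p, hp⟩ := exists_asympCenter_eq H (x ∘ φ)
      ((mul_le_mul_of_nonneg_left hr hk.le).trans_lt (H.lt _ _))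
    exact ⟨p, mem_argmin_of_asympCenter H hf (fun z => hv ▸ hu (mem_univ z))
      (fun ε hε => hφ.tendsto_atTop.eventually (hnear ε hε)) hp, hp⟩
  have hlimsup : ∀ p ∈ argmin f, ∀ φ : ℕ → ℕ, StrictMono φ →
      limsupDist (x ∘ φ) p = ⨅ n, dist (x n) p := by
    intro p hp φ hφ
    have h1 := tendsto_atTop_ciInf (h.antitone_dist H hf hp)
      ⟨0, by rintro _ ⟨n, rfl⟩; exact dist_nonneg⟩
    have h2 : Tendsto (fun n => dist p ((x ∘ φ) n)) atTop (𝓝 (⨅ n, dist (x n) p)) := by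
      simp only [dist_comm p]
      exact h1.comp hφ.tendsto_atTop
    exact h2.limsup_eq
  obtain ⟨p, hp, hpc⟩ := hmin id strictMono_id
  have hx : DeltaConverges x p := by
    intro φ hφ
    obtain ⟨q, hq, hqc⟩ := hmin φ hφ
    rw [hqc]
    have h1 : limsupDist (x ∘ id) p = asympRadius (x ∘ id) := by
      have : p ∈ asympCenter (x ∘ id) := hpc ▸ mem_singleton p
      exact this
    have h2 : limsupDist (x ∘ φ) q = asympRadius (x ∘ φ) := by
      have : q ∈ asympCenter (x ∘ φ) := hqc ▸ mem_singleton q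
      exact this
    have h3 := asympRadius_le H (x ∘ id) q
    rw [← h1, hlimsup p hp id strictMono_id, hlimsup q hq id strictMono_id] at h3
    have h4 : p ∈ asympCenter (x ∘ φ) := by
      refine le_antisymm ?_ (asympRadius_le H _ p)
      rw [← h2, hlimsup p hp φ hφ, hlimsup q hq φ hφ]
      exact h3
    rw [hqc, mem_singleton_iff] at h4
    rw [h4]
  refine ⟨p, hp, hx, fun φ hφ => ?_⟩
  have hfun : limsupDist (y ∘ φ) = limsupDist (x ∘ φ) :=
    funext fun z => (limsupDist_congr H (hlim.comp hφ.tendsto_atTop) z).symm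
  have : asympCenter (y ∘ φ) = asympCenter (x ∘ φ) := by
    simp only [asympCenter, asympRadius, hfun]
  rw [this, hx φ hφ]

end CATProx

end

/-! ### Conclusion -/

theorem corollary6p1 {X : Type*} [MetricSpace X] [CompleteSpace X]
    (κ : ℝ) (hκ : 0 < κ) (hX : IsCAT κ X)
    (hdiam : ∀ w w' : X, dist w w' < diamModel κ / 2)
    (f : X → EReal) (hf : IsProperLscConvex f)
    (a lam : ℕ → ℝ) (ha : ∀ n, a n ∈ Set.Ico (0 : ℝ) 1) (hlam : ∀ n, 0 < lam n)
    (hsum : Filter.Tendsto (fun N => ∑ n ∈ Finset.range N, (1 - a n) * lam n)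
      Filter.atTop Filter.atTop)
    (x : ℕ → X)
    (hx : ∀ n, IsConvexComb (a n) (x n) (proxResolvent κ f (lam n) (x n)) (x (n + 1))) :
    (∀ η : ℝ, 0 < η → ∀ y : X, argmin (proxObjective κ f η y) = {proxResolvent κ f η y}) ∧
    ((argmin f).Nonempty ↔
      asympRadius (fun n => proxResolvent κ f (lam n) (x n)) < diamModel κ / 2 ∧
      (⨆ n, dist (proxResolvent κ f (lam n) (x n)) (x n)) < diamModel κ / 2) ∧
    ((argmin f).Nonempty → (⨆ n, a n) < 1 →
      ∃ p ∈ argmin f, DeltaConverges x p ∧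
        DeltaConverges (fun n => proxResolvent κ f (lam n) (x n)) p) := by
  have H : HalfSpherical (√κ) X := hX.halfSpherical hκ hdiam
  have hk := H.pos
  have hD : ∀ r, r < diamModel κ / 2 ↔ √κ * r < Real.pi / 2 := fun r => by
    rw [diamModel, div_right_comm, lt_div_iff₀ hk, mul_comm]
  have hprox : ∀ η : ℝ, 0 < η → ∀ y : X,
      argmin (proxObjective κ f η y) = {proxResolvent κ f η y} :=
    fun η hη y => argmin_proxObjective_eq H hf hη y
  have h : IsMannProx κ f a lam x fun n => proxResolvent κ f (lam n) (x n) :=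
    ⟨ha, hlam, fun n => hprox _ (hlam n) (x n) ▸ Set.mem_singleton _, hx⟩
  have : Nonempty X := ⟨x 0⟩
  refine ⟨hprox, ⟨?_, ?_⟩, ?_⟩
  · rintro ⟨u, hu⟩
    -- Fejér monotonicity bounds both quantities by the single distance from `x 0` to a minimizer,
    -- which makes the strict inequality survive the supremum.
    refine ⟨lt_of_le_of_lt ?_ (hdiam (x 0) u), lt_of_le_of_lt ?_ (hdiam (x 0) u)⟩
    · refine (asympRadius_le H _ u).trans
        (limsupDist_le_of_eventually (Filter.Eventually.of_forall fun n => ?_))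
      rw [dist_comm]
      exact (h.dist_le_of_le H hf (hu (Set.mem_univ _))).trans
        (h.antitone_dist H hf hu (Nat.zero_le n))
    · exact ciSup_le fun n => h.dist_resolvent_le H hf hu n
  · rintro ⟨h1, h2⟩
    refine h.argmin_nonempty H hf hsum ((hD _).1 h2) (fun n => ?_) ((hD _).1 h1)
    exact le_ciSup (f := fun n => dist (proxResolvent κ f (lam n) (x n)) (x n))
      ⟨diamModel κ / 2, by rintro _ ⟨n, rfl⟩; exact (hdiam _ _).le⟩ n
  · intro hne hA
    exact h.exists_deltaConverges H hf hsum hA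
      (fun n => le_ciSup ⟨1, by rintro _ ⟨n, rfl⟩; exact (ha n).2.le⟩ n) hne
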